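/- Let $r\ge 1$ and $t\in\{1,2\}$ be integers and put $n=2r+t$. Let $G_{r,t}$ be the simple graph with the $2n+2$ vertices $x,\ y,\ u_0,\dots,u_{n-1},\ v_0,\dots,v_{n-1}$ and exactly the following edges: - $xu_i$ and $yv_i$ for all $0\le i<n$; - $u_iv_j$ whenever $j\in\{i,i+1,\dots,i+r+1\}$ modulo $n$; - if $t=1$: $u_iu_j$ and $v_iv_j$ for all $i\ne j$ (so $N(x)$ and $N(y)$ each induce $K_{2r+1}$); - if $t=2$: $u_iu_j$ and $v_iv_j$ for all $i\neq j$ except the pairs $\{i,j\}=\{k,k+r+1\}$, $0\le k\le r$ (so $N(x)$ and $N(y)$ each induce $K_{2r+2}$ minus a perfect matching). For vertices $a\ne b$ of a finite connected graph $G$ let $\kappa(a,b)=\lim_{\alpha\to1^-}\frac{1}{1-\alpha}\Bigl(1-\frac{W(m_a^\alpha,m_b^\alpha)}{d(a,b)}\Bigr)$ be the Lin–Lu–Yau curvature, where $d$ is the graph distance, $m_a^\alpha$ is the distribution giving mass $\alpha$ to $a$ and $(1-\alpha)/\deg(a)$ to each neighbor of $a$, and $W(m_1,m_2)$ is the transportation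 distance, i.e. the infimum of $\sum_{p,q}A(p,q)\,d(p,q)$ over all couplings $A$ of $m_1$ and $m_2$. Let $\kappa_{\min}(G)$ be the minimum of $\kappa(a,b)$ over the edges $ab$. A connected graph $G$ is Bonnet–Myers sharp if $\operatorname{diam}(G)=2/\kappa_{\min}(G)$ (with $\kappa_{\min}(G)>0$). Then for every $r\ge1$ and $t\in\{1,2\}$ the graph $G_{r,t}$ has diameter $3$ and is Bonnet–Myers sharp, $d(x,y)=3$ (so $x,y$ is a pair of poles), and $G_{r,t}$ is irregular (not $d$-regular for any $d$). Moreover, graphs $G_{r,t}$ for distinct pairs $(r,t)$ are non-isomorphic; in particular there are infinitely many irregular Bonnet–Myers sharp graphs of diameter $3$. -/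

import Mathlib

open Filter Topology

namespace LLY

variable {V : Type*}

/-- A coupling between two finitely supported distributions `m₁`, `m₂` on a finite vertex set. -/
structure IsCoupling [Fintype V] (m₁ m₂ : V → ℝ) (A : V → V → ℝ) : Prop where
  mem_unit : ∀ a b, 0 ≤ A a b ∧ A a b ≤ 1
  fst_marginal : ∀ a, ∑ b, A a b = m₁ a
  snd_marginal : ∀ b, ∑ a, A a b = m₂ b

/-- The transportation distance: the infimum, over all couplings `A` of `m₁` and `m₂`, of the
cost `∑ A(a,b) d(a,b)`, where `d` is the graph distance. -/
noncomputable def transportDist [Fintype V] (G : SimpleGraph V) (m₁ m₂ : V → ℝ) : ℝ :=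
  sInf {c : ℝ | ∃ A : V → V → ℝ, IsCoupling m₁ m₂ A ∧ c = ∑ a, ∑ b, A a b * (G.dist a b : ℝ)}

open Classical in
/-- The `α`-lazy random walk `m_a^α`. -/
noncomputable def lazyWalk [Fintype V] (G : SimpleGraph V) (α : ℝ) (a : V) : V → ℝ := fun b =>
  if b = a then α else if G.Adj a b then (1 - α) / (G.degree a : ℝ) else 0

/-- The `α`-Ricci curvature `κ_α(a,b) = 1 - W(m_a^α, m_b^α) / d(a,b)`. -/
noncomputable def alphaCurvature [Fintype V] (G : SimpleGraph V) (α : ℝ) (a b : V) : ℝ :=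
  1 - transportDist G (lazyWalk G α a) (lazyWalk G α b) / (G.dist a b : ℝ)

/-- The Lin-Lu-Yau curvature `κ(a,b) = lim_{α → 1⁻} κ_α(a,b) / (1 - α)` exists and equals `k`. -/
def HasCurvature [Fintype V] (G : SimpleGraph V) (a b : V) (k : ℝ) : Prop :=
  Tendsto (fun α : ℝ => alphaCurvature G α a b / (1 - α)) (𝓝[<] 1) (𝓝 k)

/-- `m` is the minimum of the Lin-Lu-Yau curvature over the edges of `G`: the curvature of every
edge exists and is at least `m`, and some edge has curvature `m`. -/
def IsMinCurvature [Fintype V] (G : SimpleGraph V) (m : ℝ) : Prop :=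
  (∀ a b, G.Adj a b → ∃ k, HasCurvature G a b k ∧ m ≤ k) ∧
    ∃ a b, G.Adj a b ∧ HasCurvature G a b m

/-- `G` is Bonnet-Myers sharp: it is connected, with `κ_min > 0`, finite diameter, and
`diam G = 2 / κ_min`. -/
def IsBonnetMyersSharp [Fintype V] (G : SimpleGraph V) : Prop :=
  G.Connected ∧ G.ediam ≠ ⊤ ∧ ∃ m : ℝ, IsMinCurvature G m ∧ 0 < m ∧ (G.diam : ℝ) = 2 / m

open Classical in
/-- `G` is irregular: it is not `d`-regular for any `d`. -/
def IsIrregular [Fintype V] (G : SimpleGraph V) : Prop :=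
  ¬ ∃ d : ℕ, G.IsRegularOfDegree d

/-- The vertices: two poles `x`, `y`, and `u_i`, `v_i` for `0 ≤ i < n`. -/
inductive PoleVertex (n : ℕ) : Type
  | x : PoleVertex n
  | y : PoleVertex n
  | u : Fin n → PoleVertex n
  | v : Fin n → PoleVertex n
  deriving DecidableEq, Fintype

/-- Adjacency of the vertices with indices `i`, `j` inside `N(x)` (and inside `N(y)`): all pairs
of distinct indices are adjacent, except that for `t = 2` the perfect matching
`{i, i + r + 1}`, `0 ≤ i ≤ r`, is removed. -/
def SideAdj (r t : ℕ) (i j : Fin (2 * r + t)) : Prop :=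
  i ≠ j ∧ (t = 2 → (j : ℕ) ≠ (i : ℕ) + (r + 1) ∧ (i : ℕ) ≠ (j : ℕ) + (r + 1))

/-- Adjacency of `u_i` and `v_j`: the index `j`, read modulo `2r + t`, is one of
`i, i + 1, …, i + r + 1`. -/
def CrossAdj (r t : ℕ) (i j : Fin (2 * r + t)) : Prop :=
  ∃ k : ℕ, k ≤ r + 1 ∧ (j : ℕ) ≡ (i : ℕ) + k [MOD 2 * r + t]

/-- The adjacency relation of the constructed graph. -/
def PoleAdj (r t : ℕ) : PoleVertex (2 * r + t) → PoleVertex (2 * r + t) → Prop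
  | .x, .u _ => True
  | .u _, .x => True
  | .y, .v _ => True
  | .v _, .y => True
  | .u i, .u j => SideAdj r t i j
  | .v i, .v j => SideAdj r t i j
  | .u i, .v j => CrossAdj r t i j
  | .v j, .u i => CrossAdj r t i j
  | _, _ => False

/-- The constructed graph with parameters `r`, `t`. -/
def poleGraph (r t : ℕ) : SimpleGraph (PoleVertex (2 * r + t)) where
  Adj := PoleAdj r t
  symm := ⟨by
    intro a b h
    cases a <;> cases b <;> simp_all [PoleAdj, SideAdj] <;> grind⟩
  loopless := ⟨by
    intro a h
    cases a <;> simp_all [PoleAdj, SideAdj]⟩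

end LLY

/-! Diameter 3 is elementary, so sharpness amounts to κ ≥ 2/3 on every edge, with equality on some
edge.

An edge missing both poles joins vertices of equal degree D = 3r + 3. With p = (1 - α)/D, each lazy
walk is p times the indicator of the closed ball plus mass α - p at the centre. The centre mass
moves across the edge, so matching the two balls at total cost k gives κ ≥ (D + 1 - k)/D
(`MovesTo.curvatureBound`). The budget k = r + 2 is exactly 2/3, and explicit matchings meet it
(`curvatureBound_u_zero_u`, `curvatureBound_u_zero_v`). Rotations and the pole-swapping reflection
reduce every such edge to one at u_0.

On an edge x u_0 the degrees differ, so mass must be split. A fractional flow from the u's to the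
v's (`exists_flow`) bounds W from above, and the 1-Lipschitz function `level` bounds it from below
by the same number, so κ = 2/3 there. Existence of the limit defining κ on every edge is a
monotonicity argument (`exists_hasCurvature`).

Irregularity is read off the degrees, and the number of vertices determines (r, t). -/

namespace LLY

/-! ### Transportation distance and Lin–Lu–Yau curvature on a finite graph -/

section Transport

variable {V : Type*} {G : SimpleGraph V}

theorem sub_le_dist (hG : G.Connected) {f : V → ℝ} (hf : ∀ a b, G.Adj a b → f b - f a ≤ 1)
    (a b : V) : f b - f a ≤ G.dist a b := by
  obtain ⟨w, hw⟩ := hG.exists_walk_length_eq_dist a b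
  rw [← hw]
  clear hw
  induction w with
  | nil => simp
  | cons h _ ih =>
    have := hf _ _ h
    simp only [SimpleGraph.Walk.length_cons]
    push_cast
    linarith

theorem dist_iso (φ : G ≃g G) (a b : V) : G.dist (φ a) (φ b) = G.dist a b := by
  have h : ∀ (φ : G ≃g G) (a b : V), G.edist (φ a) (φ b) ≤ G.edist a b := by
    intro φ a b
    refine le_iInf fun w => ?_
    simpa using SimpleGraph.edist_le (w.map φ.toHom)
  refine congrArg ENat.toNat (le_antisymm (h φ a b) ?_)
  simpa using h φ.symm (φ a) (φ b)

/-- The points of `S` can be moved bijectively onto `T` at total cost at most `k`. -/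
def MovesTo (G : SimpleGraph V) (S T : Finset V) (k : ℕ) : Prop :=
  ∃ φ : V → V, Set.BijOn φ S T ∧ ∑ z ∈ S, G.dist z (φ z) ≤ k

theorem MovesTo.trans (hG : G.Connected) {S T U : Finset V} {k l : ℕ} (h₁ : MovesTo G S T k)
    (h₂ : MovesTo G T U l) : MovesTo G S U (k + l) := by
  obtain ⟨φ, hφ, hk⟩ := h₁
  obtain ⟨ψ, hψ, hl⟩ := h₂
  refine ⟨ψ ∘ φ, hψ.comp hφ, ?_⟩
  have e : ∑ z ∈ S, G.dist (φ z) (ψ (φ z)) = ∑ w ∈ T, G.dist w (ψ w) :=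
    Finset.sum_nbij φ (fun z hz => hφ.mapsTo hz) hφ.injOn hφ.surjOn fun _ _ => rfl
  calc _ ≤ ∑ z ∈ S, (G.dist z (φ z) + G.dist (φ z) (ψ (φ z))) :=
        Finset.sum_le_sum fun z _ => hG.dist_triangle
    _ ≤ k + l := by rw [Finset.sum_add_distrib, e]; omega

/-- It suffices to move the points of `S \ T` onto `T \ S`. -/
theorem movesTo_of_bijOn_sdiff [DecidableEq V] {S T : Finset V} {φ : V → V} {c k : ℕ}
    (hφ : Set.BijOn φ ↑(S \ T) ↑(T \ S)) (hc : ∀ z ∈ S \ T, G.dist z (φ z) ≤ c)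
    (hk : (S \ T).card * c ≤ k) : MovesTo G S T k := by
  have h1 : Set.EqOn φ (fun z => if z ∈ T then z else φ z) ↑(S \ T) := by
    intro z hz
    have : z ∉ T := by simp at hz; exact hz.2
    simp [this]
  have h2 : Set.BijOn (fun z => if z ∈ T then z else φ z) ↑(S ∩ T) ↑(S ∩ T) := by
    refine (Set.bijOn_id _).congr fun z hz => ?_
    have : z ∈ T := by simp at hz; exact hz.2
    simp [this]
  refine ⟨fun z => if z ∈ T then z else φ z, ?_, ?_⟩
  · have hS : (S : Set V) = ↑(S \ T) ∪ ↑(S ∩ T) := by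
      rw [← Finset.coe_union, Finset.sdiff_union_inter]
    have hT : (T : Set V) = ↑(T \ S) ∪ ↑(S ∩ T) := by
      rw [← Finset.coe_union, Finset.inter_comm, Finset.sdiff_union_inter]
    rw [hS, hT]
    refine (hφ.congr h1).union h2 ?_
    refine (Set.injOn_union ?_).2 ⟨(hφ.congr h1).injOn, h2.injOn, ?_⟩
    · exact Finset.disjoint_coe.2 (Finset.disjoint_sdiff_inter S T)
    · intro z hz w hw e
      have hz' := (hφ.congr h1).mapsTo hz
      rw [e] at hz'
      have hw' := h2.mapsTo hw
      simp only [Finset.coe_sdiff, Finset.coe_inter, Set.mem_sdiff, Set.mem_inter_iff] at hz' hw'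
      exact hz'.2 hw'.1
  · refine le_trans ?_ hk
    rw [← Finset.sum_sdiff (Finset.inter_subset_left : S ∩ T ⊆ S), Finset.sdiff_inter_self_left,
      Finset.sum_eq_zero (s := S ∩ T), add_zero]
    · refine Finset.sum_le_card_nsmul _ _ c fun z hz => ?_
      simpa only [if_neg (Finset.mem_sdiff.1 hz).2] using hc z hz
    · intro z hz
      simp only [if_pos (Finset.mem_inter.1 hz).2, SimpleGraph.dist_self]

/-- Moving along an indexed family of pairs: `S \ T` is listed by `f` and `T \ S` by `g`. -/
theorem movesTo_of_range [DecidableEq V] {S T : Finset V} {m c k : ℕ} (f g : Fin m → V)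
    (hf : f.Injective) (hg : g.Injective) (hS : ∀ z, z ∈ S ∧ z ∉ T ↔ ∃ i, f i = z)
    (hT : ∀ z, z ∈ T ∧ z ∉ S ↔ ∃ i, g i = z) (hc : ∀ i, G.dist (f i) (g i) ≤ c)
    (hk : m * c ≤ k) : MovesTo G S T k := by
  have hS' : S \ T = Finset.univ.image f := by ext z; simp [← hS z]
  have hT' : T \ S = Finset.univ.image g := by ext z; simp [← hT z]
  -- `Function.extend` makes a self-map of `V` out of the matching; its default `id` is never used
  -- on `S \ T`.
  have hφ : ∀ i, Function.extend f g id (f i) = g i := fun i => hf.extend_apply g id i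
  refine movesTo_of_bijOn_sdiff (φ := Function.extend f g id) (c := c) ?_ ?_ ?_
  · rw [hS', hT']
    refine ⟨?_, ?_, ?_⟩
    · intro z hz
      obtain ⟨i, -, rfl⟩ := Finset.mem_image.1 (Finset.mem_coe.1 hz)
      simp [hφ]
    · intro z hz w hw e
      obtain ⟨i, -, rfl⟩ := Finset.mem_image.1 (Finset.mem_coe.1 hz)
      obtain ⟨j, -, rfl⟩ := Finset.mem_image.1 (Finset.mem_coe.1 hw)
      rw [hφ, hφ] at e
      rw [hg e]
    · intro w hw
      obtain ⟨i, -, rfl⟩ := Finset.mem_image.1 (Finset.mem_coe.1 hw)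
      exact ⟨f i, by simp, hφ i⟩
  · rw [hS']
    intro z hz
    obtain ⟨i, -, rfl⟩ := Finset.mem_image.1 hz
    rw [hφ]
    exact hc i
  · rwa [hS', Finset.card_image_of_injective _ hf, Finset.card_univ, Fintype.card_fin]

/-- Moving a single point. -/
theorem movesTo_single [DecidableEq V] {S T : Finset V} {k : ℕ} (a b : V)
    (hS : ∀ z, z ∈ S ∧ z ∉ T ↔ z = a) (hT : ∀ z, z ∈ T ∧ z ∉ S ↔ z = b)
    (hk : G.dist a b ≤ k) : MovesTo G S T k :=
  movesTo_of_range (m := 1) (fun _ => a) (fun _ => b) (Function.injective_of_subsingleton _)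
    (Function.injective_of_subsingleton _) (fun z => by simp [hS, eq_comm])
    (fun z => by simp [hT, eq_comm]) (fun _ => hk) (by simp)

variable [Fintype V]

theorem bddBelow_transportCosts (G : SimpleGraph V) (m₁ m₂ : V → ℝ) :
    BddBelow {c : ℝ | ∃ A : V → V → ℝ, IsCoupling m₁ m₂ A ∧
      c = ∑ a, ∑ b, A a b * (G.dist a b : ℝ)} := by
  refine ⟨0, ?_⟩
  rintro c ⟨A, hA, rfl⟩
  exact Finset.sum_nonneg fun a _ => Finset.sum_nonneg fun b _ =>
    mul_nonneg (hA.mem_unit a b).1 (Nat.cast_nonneg _)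

theorem transportDist_le {m₁ m₂ : V → ℝ} {A : V → V → ℝ} (hA : IsCoupling m₁ m₂ A) :
    transportDist G m₁ m₂ ≤ ∑ a, ∑ b, A a b * (G.dist a b : ℝ) :=
  csInf_le (bddBelow_transportCosts G m₁ m₂) ⟨A, hA, rfl⟩

theorem isCoupling_of_nonneg {m₁ m₂ : V → ℝ} {A : V → V → ℝ} (hA : ∀ a b, 0 ≤ A a b)
    (h₁ : ∀ a, ∑ b, A a b = m₁ a) (h₂ : ∀ b, ∑ a, A a b = m₂ b) (hm : ∀ a, m₁ a ≤ 1) :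
    IsCoupling m₁ m₂ A where
  mem_unit a b := ⟨hA a b, (Finset.single_le_sum (fun c _ => hA a c)
    (Finset.mem_univ b)).trans ((h₁ a).trans_le (hm a))⟩
  fst_marginal := h₁
  snd_marginal := h₂

/-- Nonnegative with total mass one. -/
structure IsDistribution (m : V → ℝ) : Prop where
  nonneg : ∀ a, 0 ≤ m a
  sum_eq_one : ∑ a, m a = 1

theorem IsDistribution.le_one {m : V → ℝ} (hm : IsDistribution m) (a : V) : m a ≤ 1 :=
  hm.sum_eq_one ▸ Finset.single_le_sum (fun b _ => hm.nonneg b) (Finset.mem_univ a)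

theorem IsDistribution.isCoupling_mul {m₁ m₂ : V → ℝ} (h₁ : IsDistribution m₁)
    (h₂ : IsDistribution m₂) : IsCoupling m₁ m₂ fun a b => m₁ a * m₂ b :=
  isCoupling_of_nonneg (fun a b => mul_nonneg (h₁.nonneg a) (h₂.nonneg b))
    (fun a => by rw [← Finset.mul_sum, h₂.sum_eq_one, mul_one])
    (fun b => by rw [← Finset.sum_mul, h₁.sum_eq_one, one_mul]) h₁.le_one

/-- The product coupling makes the set of costs nonempty; without it the real `sInf` could be the
default 0 and no lower bound would follow. -/
theorem le_transportDist {m₁ m₂ : V → ℝ} (h₁ : IsDistribution m₁) (h₂ : IsDistribution m₂) {k : ℝ}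
    (h : ∀ A, IsCoupling m₁ m₂ A → k ≤ ∑ a, ∑ b, A a b * (G.dist a b : ℝ)) :
    k ≤ transportDist G m₁ m₂ := by
  refine le_csInf ⟨_, _, h₁.isCoupling_mul h₂, rfl⟩ ?_
  rintro c ⟨A, hA, rfl⟩
  exact h A hA

/-- The easy half of Kantorovich duality. -/
theorem sum_sub_sum_le_transportDist (hG : G.Connected) {f : V → ℝ}
    (hf : ∀ a b, G.Adj a b → f b - f a ≤ 1) {m₁ m₂ : V → ℝ}
    (h₁ : IsDistribution m₁) (h₂ : IsDistribution m₂) :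
    ∑ b, m₂ b * f b - ∑ a, m₁ a * f a ≤ transportDist G m₁ m₂ := by
  refine le_transportDist h₁ h₂ fun A hA => ?_
  have e₁ : ∑ a, m₁ a * f a = ∑ a, ∑ b, A a b * f a :=
    Finset.sum_congr rfl fun a _ => by rw [← hA.fst_marginal a, Finset.sum_mul]
  have e₂ : ∑ b, m₂ b * f b = ∑ a, ∑ b, A a b * f b := by
    rw [Finset.sum_comm]
    exact Finset.sum_congr rfl fun b _ => by rw [← hA.snd_marginal b, Finset.sum_mul]
  rw [e₁, e₂, ← Finset.sum_sub_distrib]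
  refine Finset.sum_le_sum fun a _ => ?_
  rw [← Finset.sum_sub_distrib]
  refine Finset.sum_le_sum fun b _ => ?_
  rw [← mul_sub]
  exact mul_le_mul_of_nonneg_left (sub_le_dist hG hf a b) (hA.mem_unit a b).1

open Classical in
theorem sum_lazyWalk_mul (α : ℝ) (a : V) (f : V → ℝ) :
    ∑ b, lazyWalk G α a b * f b =
      α * f a + (1 - α) / (G.degree a : ℝ) * ∑ b, if G.Adj a b then f b else 0 := by
  have h : ∀ b, lazyWalk G α a b * f b = (if b = a then α * f a else 0) +
      (1 - α) / (G.degree a : ℝ) * (if G.Adj a b then f b else 0) := by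
    intro b
    unfold lazyWalk
    by_cases hb : b = a
    · subst hb; simp
    · by_cases hab : G.Adj a b <;> simp [hb, hab]
  simp_rw [h, Finset.sum_add_distrib, ← Finset.mul_sum]
  simp

open Classical in
theorem sum_adj_eq_degree (a : V) :
    ∑ b, (if G.Adj a b then (1 : ℝ) else 0) = G.degree a := by
  rw [Finset.sum_boole, ← SimpleGraph.card_neighborFinset_eq_degree]
  congr 2
  ext b
  simp

open Classical in
theorem isDistribution_lazyWalk {α : ℝ} (h₀ : 0 ≤ α) (h₁ : α ≤ 1) {a b : V} (hab : G.Adj a b) :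
    IsDistribution (lazyWalk G α a) where
  nonneg z := by
    unfold lazyWalk
    have : 0 ≤ (1 - α) / (G.degree a : ℝ) := div_nonneg (by linarith) (Nat.cast_nonneg _)
    split_ifs <;> simp [*]
  sum_eq_one := by
    have hd : (G.degree a : ℝ) ≠ 0 := by
      have := (G.degree_pos_iff_exists_adj a).2 ⟨b, hab⟩
      exact_mod_cast this.ne'
    have := sum_lazyWalk_mul (G := G) α a fun _ => 1
    rw [sum_adj_eq_degree, div_mul_cancel₀ _ hd] at this
    simpa using this

theorem transportDist_comm (m₁ m₂ : V → ℝ) :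
    transportDist G m₁ m₂ = transportDist G m₂ m₁ := by
  unfold transportDist
  congr 1
  ext c
  constructor <;>
  · rintro ⟨A, hA, rfl⟩
    refine ⟨fun a b => A b a, ⟨fun a b => hA.mem_unit b a, hA.snd_marginal, hA.fst_marginal⟩, ?_⟩
    rw [Finset.sum_comm]
    simp_rw [SimpleGraph.dist_comm]

open Classical in
theorem degree_iso (φ : G ≃g G) (a : V) : G.degree (φ a) = G.degree a := by
  have : (G.degree (φ a) : ℝ) = G.degree a := by
    rw [← sum_adj_eq_degree, ← sum_adj_eq_degree, ← Equiv.sum_comp φ.toEquiv]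
    exact Finset.sum_congr rfl fun b _ => by simp [φ.map_adj_iff]
  exact_mod_cast this

open Classical in
theorem lazyWalk_iso (φ : G ≃g G) (α : ℝ) (a b : V) :
    lazyWalk G α (φ a) (φ b) = lazyWalk G α a b := by
  unfold lazyWalk
  simp only [φ.injective.eq_iff, φ.map_adj_iff, degree_iso]

/-- Any coupling can be carried along the automorphism at equal cost, since automorphisms preserve
distance. -/
theorem transportDist_iso_le (φ : G ≃g G) {m₁ m₂ : V → ℝ}
    (h₁ : IsDistribution m₁) (h₂ : IsDistribution m₂) {m₁' m₂' : V → ℝ}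
    (e₁ : ∀ a, m₁' (φ a) = m₁ a) (e₂ : ∀ a, m₂' (φ a) = m₂ a) :
    transportDist G m₁' m₂' ≤ transportDist G m₁ m₂ := by
  refine le_transportDist h₁ h₂ fun A hA => ?_
  have hB : IsCoupling m₁' m₂' fun a b => A (φ.symm a) (φ.symm b) := by
    refine ⟨fun a b => hA.mem_unit _ _, fun a => ?_, fun b => ?_⟩
    · obtain ⟨a, rfl⟩ := φ.surjective a
      rw [e₁, ← hA.fst_marginal a, ← Equiv.sum_comp φ.toEquiv]
      simp
    · obtain ⟨b, rfl⟩ := φ.surjective b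
      rw [e₂, ← hA.snd_marginal b, ← Equiv.sum_comp φ.toEquiv]
      simp
  refine (transportDist_le hB).trans_eq ?_
  rw [← Equiv.sum_comp φ.toEquiv]
  refine Finset.sum_congr rfl fun a _ => ?_
  rw [← Equiv.sum_comp φ.toEquiv]
  exact Finset.sum_congr rfl fun b _ => by simp [dist_iso]

/-- Near `α = 1` the lazy walks at `a`, `b` are at distance at most `1 - k (1 - α)`. -/
def CurvatureBound (G : SimpleGraph V) (k : ℝ) (a b : V) : Prop :=
  ∀ᶠ α in 𝓝[<] (1 : ℝ),
    transportDist G (lazyWalk G α a) (lazyWalk G α b) ≤ 1 - k * (1 - α)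

theorem CurvatureBound.symm {k : ℝ} {a b : V} (h : CurvatureBound G k a b) :
    CurvatureBound G k b a := by
  filter_upwards [h] with α hα
  rwa [transportDist_comm]

theorem eventually_mem_Ico {c : ℝ} (hc : c < 1) : ∀ᶠ α in 𝓝[<] (1 : ℝ), α ∈ Set.Ico c 1 :=
  Ico_mem_nhdsLT hc

/-- This is what allows each edge orbit to be checked at a single representative. -/
theorem CurvatureBound.iso (φ : G ≃g G) {k : ℝ} {a b : V} (hab : G.Adj a b)
    (h : CurvatureBound G k a b) : CurvatureBound G k (φ a) (φ b) := by
  filter_upwards [h, eventually_mem_Ico zero_lt_one] with α hα h01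
  exact (transportDist_iso_le φ (isDistribution_lazyWalk h01.1 h01.2.le hab)
    (isDistribution_lazyWalk h01.1 h01.2.le hab.symm) (lazyWalk_iso φ α a)
    (lazyWalk_iso φ α b)).trans hα

open Classical in
theorem lazyWalk_convex {α β l : ℝ} (h : 1 - β = l * (1 - α)) (a z : V) :
    lazyWalk G β a z = l * lazyWalk G α a z + if z = a then 1 - l else 0 := by
  unfold lazyWalk
  by_cases hz : z = a
  · simp only [hz, if_true]; linarith
  · by_cases hz' : G.Adj a z
    · simp only [hz, hz', if_true, if_false, h, mul_div_assoc, add_zero]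
    · simp [hz, hz']

open Classical in
-- The lazier walk is the mixture of l times the original walk and 1 - l times the point mass at its
-- base. Scale a coupling by l and send the remaining 1 - l from `a` to `b` at cost 1.
theorem transportDist_lazyWalk_le {α β l : ℝ} (hα₀ : 0 ≤ α) (hα : α ≤ 1) (hl₀ : 0 < l) (hl : l ≤ 1)
    (h : 1 - β = l * (1 - α)) {a b : V} (hab : G.Adj a b) :
    transportDist G (lazyWalk G β a) (lazyWalk G β b) ≤
      l * transportDist G (lazyWalk G α a) (lazyWalk G α b) + (1 - l) := by
  have key : (transportDist G (lazyWalk G β a) (lazyWalk G β b) - (1 - l)) / l ≤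
      transportDist G (lazyWalk G α a) (lazyWalk G α b) := by
    refine le_transportDist (isDistribution_lazyWalk hα₀ hα hab)
      (isDistribution_lazyWalk hα₀ hα hab.symm) fun A hA => ?_
    have hB : IsCoupling (lazyWalk G β a) (lazyWalk G β b)
        fun z w => l * A z w + if z = a then (if w = b then 1 - l else 0) else 0 := by
      refine isCoupling_of_nonneg ?_ ?_ ?_ ?_
      · intro z w
        have := mul_nonneg hl₀.le (hA.mem_unit z w).1
        split_ifs <;> linarith
      · intro z
        rw [Finset.sum_add_distrib, ← Finset.mul_sum, hA.fst_marginal, lazyWalk_convex h]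
        by_cases hz : z = a <;> simp [hz]
      · intro w
        rw [Finset.sum_add_distrib, ← Finset.mul_sum, hA.snd_marginal, lazyWalk_convex h]
        simp
      · exact (isDistribution_lazyWalk (by nlinarith) (by nlinarith) hab).le_one
    have := transportDist_le (G := G) hB
    simp only [add_mul, Finset.sum_add_distrib, ite_mul, zero_mul, mul_assoc,
      ← Finset.mul_sum] at this
    simp only [Finset.sum_ite_eq', Finset.mem_univ, if_true, Finset.sum_ite_irrel,
      Finset.sum_const_zero, SimpleGraph.dist_eq_one_iff_adj.2 hab] at this
    rw [div_le_iff₀ hl₀]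
    push_cast at this
    linarith
  rw [div_le_iff₀ hl₀] at key
  linarith

open Classical in
-- Test against the distance from `a`: its mean is 1 - α for the walk at `a` and at least α for the
-- walk at `b`. This caps the curvature quotient by 2.
theorem two_mul_sub_one_le_transportDist (hG : G.Connected) {α : ℝ} (h₀ : 0 ≤ α) (h₁ : α ≤ 1)
    {a b : V} (hab : G.Adj a b) :
    2 * α - 1 ≤ transportDist G (lazyWalk G α a) (lazyWalk G α b) := by
  have hf : ∀ z w, G.Adj z w → (G.dist a w : ℝ) - G.dist a z ≤ 1 := by
    intro z w hzw
    have := hG.dist_triangle (u := a) (v := z) (w := w)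
    rw [SimpleGraph.dist_eq_one_iff_adj.2 hzw] at this
    have : (G.dist a w : ℝ) ≤ G.dist a z + 1 := by exact_mod_cast this
    linarith
  have key := sum_sub_sum_le_transportDist hG hf (isDistribution_lazyWalk h₀ h₁ hab)
    (isDistribution_lazyWalk h₀ h₁ hab.symm)
  rw [sum_lazyWalk_mul, sum_lazyWalk_mul] at key
  have hd : (G.degree a : ℝ) ≠ 0 := by
    have := (G.degree_pos_iff_exists_adj a).2 ⟨b, hab⟩
    exact_mod_cast this.ne'
  have e : ∑ z, (if G.Adj a z then (G.dist a z : ℝ) else 0) = G.degree a := by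
    rw [← sum_adj_eq_degree]
    refine Finset.sum_congr rfl fun z _ => ?_
    by_cases hz : G.Adj a z
    · simp [hz, SimpleGraph.dist_eq_one_iff_adj.2 hz]
    · simp [hz]
  rw [e, div_mul_cancel₀ _ hd, SimpleGraph.dist_eq_one_iff_adj.2 hab] at key
  have : 0 ≤ (1 - α) / (G.degree b : ℝ) * ∑ z, if G.Adj b z then (G.dist a z : ℝ) else 0 :=
    mul_nonneg (div_nonneg (by linarith) (Nat.cast_nonneg _))
      (Finset.sum_nonneg fun z _ => by split_ifs <;> positivity)
  simp at key
  linarith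

theorem alphaCurvature_of_adj {α : ℝ} {a b : V} (hab : G.Adj a b) :
    alphaCurvature G α a b = 1 - transportDist G (lazyWalk G α a) (lazyWalk G α b) := by
  simp [alphaCurvature, SimpleGraph.dist_eq_one_iff_adj.2 hab]

/-- The quotient is nondecreasing in α by `transportDist_lazyWalk_le` and bounded above by 2, so its
left limit at 1 exists. -/
theorem exists_hasCurvature (hG : G.Connected) {a b : V} (hab : G.Adj a b) :
    ∃ k, HasCurvature G a b k := by
  have hmono : MonotoneOn (fun α : ℝ => alphaCurvature G α a b / (1 - α)) (Set.Ioo 0 1) := by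
    intro α hα β hβ hαβ
    have h1 : 0 < 1 - α := by linarith [hα.2]
    have h2 : 0 < 1 - β := by linarith [hβ.2]
    have key := transportDist_lazyWalk_le (G := G) (l := (1 - β) / (1 - α)) hα.1.le hα.2.le
      (div_pos h2 h1) ((div_le_one h1).2 (by linarith)) (div_mul_cancel₀ _ h1.ne').symm hab
    simp only [alphaCurvature_of_adj hab]
    rw [le_div_iff₀ h2]
    calc _ = (1 - β) / (1 - α) *
          (1 - transportDist G (lazyWalk G α a) (lazyWalk G α b)) := by ring
      _ ≤ _ := by linarith
  have hbdd : BddAbove ((fun α : ℝ => alphaCurvature G α a b / (1 - α)) '' Set.Ioo 0 1) := by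
    refine ⟨2, ?_⟩
    rintro _ ⟨α, hα, rfl⟩
    have h1 : 0 < 1 - α := by linarith [hα.2]
    have := two_mul_sub_one_le_transportDist hG hα.1.le hα.2.le hab
    simp only [alphaCurvature_of_adj hab]
    rw [div_le_iff₀ h1]
    linarith
  exact ⟨_, hmono.tendsto_nhdsWithin_Ioo_left (Set.nonempty_Ioo.2 zero_lt_one) hbdd⟩

theorem CurvatureBound.le_of_hasCurvature {k c : ℝ} {a b : V} (hab : G.Adj a b)
    (h : CurvatureBound G k a b) (hc : HasCurvature G a b c) : k ≤ c := by
  refine ge_of_tendsto hc ?_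
  filter_upwards [h, eventually_mem_Ico zero_lt_one] with α hα h01
  rw [le_div_iff₀ (by linarith [h01.2]), alphaCurvature_of_adj hab]
  linarith

open Classical in
theorem MovesTo.curvatureBound {a b : V} {D k : ℕ} (hab : G.Adj a b) (hD : 0 < D)
    (ha : G.degree a = D) (hb : G.degree b = D)
    {S T : Finset V} (hS : ∀ z, z ∈ S ↔ z = a ∨ G.Adj a z) (hT : ∀ z, z ∈ T ↔ z = b ∨ G.Adj b z)
    (h : MovesTo G S T k) : CurvatureBound G ((D + 1 - k) / D) a b := by
  obtain rfl : S = insert a (G.neighborFinset a) := by ext z; simp [hS z]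
  obtain rfl : T = insert b (G.neighborFinset b) := by ext z; simp [hT z]
  obtain ⟨φ, hφ, hk⟩ := h
  have hDR : (0 : ℝ) < D := by exact_mod_cast hD
  -- From α = 1/(D + 1) on, p ≤ α, so the surplus α - p at the centre is nonnegative; at equality
  -- the walk is uniform on the closed ball.
  filter_upwards [eventually_mem_Ico (c := 1 / (D + 1))
    (by rw [div_lt_one (by positivity)]; linarith)] with α hα
  have hα₀ : 0 ≤ α := le_trans (by positivity) hα.1
  set p : ℝ := (1 - α) / D with hp
  have hpD : p * D = 1 - α := div_mul_cancel₀ _ hDR.ne'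
  have hp₀ : 0 ≤ p := div_nonneg (by linarith [hα.2]) hDR.le
  have hpα : p ≤ α := by
    have := hα.1
    rw [div_le_iff₀ (by positivity)] at this
    rw [hp, div_le_iff₀ hDR]
    linarith
  have hw : ∀ c z, G.degree c = D → lazyWalk G α c z =
      (if z ∈ insert c (G.neighborFinset c) then p else 0) + if z = c then α - p else 0 := by
    intro c z hc
    unfold lazyWalk
    rw [hc]
    by_cases hz : z = c
    · simp [hz]
    · by_cases hz' : G.Adj c z <;> simp [hz, hz', hp]
  have hB : IsCoupling (lazyWalk G α a) (lazyWalk G α b)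
      -- Each ball point ships p along φ, and the surplus at `a` goes to `b`.
      fun z w => (if z ∈ insert a (G.neighborFinset a) then (if w = φ z then p else 0) else 0) +
        if z = a then (if w = b then α - p else 0) else 0 := by
    refine isCoupling_of_nonneg ?_ ?_ ?_ (isDistribution_lazyWalk hα₀ hα.2.le hab).le_one
    · intro z w
      have : 0 ≤ α - p := by linarith
      positivity
    · intro z
      rw [Finset.sum_add_distrib, hw a z ha]
      congr 1 <;> split_ifs <;> simp
    · intro w
      rw [Finset.sum_add_distrib, hw b w hb]
      congr 1
      · rw [← Finset.sum_filter, Finset.filter_mem_eq_inter, Finset.univ_inter]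
        by_cases hwb : w ∈ insert b (G.neighborFinset b)
        · obtain ⟨z, hz, rfl⟩ := hφ.surjOn hwb
          rw [if_pos hwb, Finset.sum_eq_single_of_mem z hz]
          · simp
          · intro y hy hyz
            rw [if_neg]
            exact fun e => hyz (hφ.injOn hy hz e.symm)
        · rw [if_neg hwb]
          refine Finset.sum_eq_zero fun z hz => if_neg ?_
          rintro rfl
          exact hwb (hφ.mapsTo hz)
      · simp
  refine (transportDist_le hB).trans ?_
  have e : ∑ z, ∑ w, ((if z ∈ insert a (G.neighborFinset a) then (if w = φ z then p else 0) else 0)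
      + if z = a then (if w = b then α - p else 0) else 0) * (G.dist z w : ℝ) =
      p * ((∑ z ∈ insert a (G.neighborFinset a), G.dist z (φ z) : ℕ) : ℝ) + (α - p) := by
    simp only [add_mul, Finset.sum_add_distrib, ite_mul, zero_mul, Finset.sum_ite_irrel,
      Finset.sum_const_zero, Finset.sum_ite_eq', Finset.mem_univ, if_true,
      SimpleGraph.dist_eq_one_iff_adj.2 hab]
    rw [← Finset.sum_filter, Finset.filter_mem_eq_inter, Finset.univ_inter]
    push_cast
    rw [Finset.mul_sum, mul_one]
  rw [e]
  have hk' : ((∑ z ∈ insert a (G.neighborFinset a), G.dist z (φ z) : ℕ) : ℝ) ≤ k := by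
    exact_mod_cast hk
  have := mul_le_mul_of_nonneg_left hk' hp₀
  have e2 : ((D : ℝ) + 1 - k) / D * (1 - α) = p * (D + 1 - k) := by rw [hp]; ring
  rw [e2]
  linarith

end Transport

theorem PoleVertex.sum_eq {n : ℕ} {M : Type*} [AddCommMonoid M] (F : PoleVertex n → M) :
    ∑ z, F z = F .x + F .y + ∑ i, F (.u i) + ∑ i, F (.v i) := by
  let e : (Unit ⊕ Unit) ⊕ (Fin n ⊕ Fin n) ≃ PoleVertex n :=
    { toFun := Sum.elim (Sum.elim (fun _ => .x) fun _ => .y) (Sum.elim .u .v)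
      invFun := fun z => match z with
        | .x => .inl (.inl ())
        | .y => .inl (.inr ())
        | .u i => .inr (.inl i)
        | .v i => .inr (.inr i)
      left_inv := by rintro ((_ | _) | (_ | _)) <;> rfl
      right_inv := by rintro (_ | _ | _ | _) <;> rfl }
  rw [← e.sum_comp]
  simp [e, Fintype.sum_sum_type, add_assoc]

theorem PoleVertex.card (n : ℕ) : Fintype.card (PoleVertex n) = 2 + 2 * n := by
  have := PoleVertex.sum_eq (n := n) fun _ => 1
  simp at this
  omega

/-! ### Adjacency in arithmetic form -/

section Adjacency

variable {r t : ℕ}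

@[simp] theorem adj_x_u (i) : (poleGraph r t).Adj .x (.u i) := trivial
@[simp] theorem adj_u_x (i) : (poleGraph r t).Adj (.u i) .x := trivial
@[simp] theorem adj_y_v (i) : (poleGraph r t).Adj .y (.v i) := trivial
@[simp] theorem adj_v_y (i) : (poleGraph r t).Adj (.v i) .y := trivial
@[simp] theorem not_adj_x_x : ¬ (poleGraph r t).Adj .x .x := id
@[simp] theorem not_adj_y_y : ¬ (poleGraph r t).Adj .y .y := id
@[simp] theorem not_adj_x_y : ¬ (poleGraph r t).Adj .x .y := id
@[simp] theorem not_adj_y_x : ¬ (poleGraph r t).Adj .y .x := id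
@[simp] theorem not_adj_x_v (i) : ¬ (poleGraph r t).Adj .x (.v i) := id
@[simp] theorem not_adj_v_x (i) : ¬ (poleGraph r t).Adj (.v i) .x := id
@[simp] theorem not_adj_y_u (i) : ¬ (poleGraph r t).Adj .y (.u i) := id
@[simp] theorem not_adj_u_y (i) : ¬ (poleGraph r t).Adj (.u i) .y := id
@[simp] theorem adj_u_u (i j) : (poleGraph r t).Adj (.u i) (.u j) ↔ SideAdj r t i j := Iff.rfl
@[simp] theorem adj_v_v (i j) : (poleGraph r t).Adj (.v i) (.v j) ↔ SideAdj r t i j := Iff.rfl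
@[simp] theorem adj_u_v (i j) : (poleGraph r t).Adj (.u i) (.v j) ↔ CrossAdj r t i j := Iff.rfl
@[simp] theorem adj_v_u (i j) : (poleGraph r t).Adj (.v j) (.u i) ↔ CrossAdj r t i j := Iff.rfl

theorem sideAdj_iff (i j : Fin (2 * r + t)) : SideAdj r t i j ↔ (i : ℕ) ≠ j ∧
    (t = 2 → (j : ℕ) ≠ (i : ℕ) + (r + 1) ∧ (i : ℕ) ≠ (j : ℕ) + (r + 1)) := by
  rw [SideAdj, ne_eq, ne_eq, Fin.ext_iff]

/-- An offset of at most r + 1 ≤ 2r + t wraps around at most once; the second alternative is the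
wrapped case. This congruence-free form is suited to `omega`. -/
theorem crossAdj_iff (hr : 1 ≤ r) (i j : Fin (2 * r + t)) :
    CrossAdj r t i j ↔ ((i : ℕ) ≤ j ∧ (j : ℕ) ≤ i + r + 1) ∨
      (j : ℕ) + (2 * r + t) ≤ i + r + 1 := by
  have hi := i.2
  have hj := j.2
  constructor
  · rintro ⟨k, hk, h⟩
    rw [Nat.ModEq, Nat.mod_eq_of_lt hj] at h
    rcases lt_or_ge ((i : ℕ) + k) (2 * r + t) with h' | h'
    · rw [Nat.mod_eq_of_lt h'] at h
      omega
    · rw [Nat.mod_eq_sub_mod h', Nat.mod_eq_of_lt (by omega)] at h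
      omega
  · rintro (h | h)
    · exact ⟨j - i, by omega, by rw [Nat.add_sub_cancel' h.1]⟩
    · refine ⟨j + (2 * r + t) - i, by omega, ?_⟩
      rw [Nat.add_sub_cancel' (by omega)]
      simp [Nat.ModEq]

end Adjacency

/-! ### Rotations and the pole-swapping reflection -/

section Automorphisms

/-- The cyclic shift of `Fin n` by `c`. -/
def shift {n : ℕ} (c : Fin n) : Equiv.Perm (Fin n) where
  toFun i := if h : (i : ℕ) + c < n then ⟨i + c, h⟩ else ⟨i + c - n, by omega⟩
  invFun i := if h : (c : ℕ) ≤ i then ⟨i - c, by omega⟩ else ⟨i + n - c, by omega⟩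
  left_inv i := by
    have hi := i.2
    by_cases h : (i : ℕ) + c < n
    · simp [h]
    · have h' : ¬ (c : ℕ) ≤ i + c - n := by omega
      ext
      simp only [h, h', dif_neg, not_false_eq_true]
      omega
  right_inv i := by
    have hi := i.2
    by_cases h : (c : ℕ) ≤ i
    · simp [h]
    · have h' : ¬ (i : ℕ) + n - c + c < n := by omega
      ext
      simp only [h, h', dif_neg, not_false_eq_true]
      omega

theorem shift_val {n : ℕ} (c i : Fin n) :
    (shift c i : ℕ) = if (i : ℕ) + c < n then (i : ℕ) + c else i + c - n := by
  simp only [shift, Equiv.coe_fn_mk]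
  split_ifs <;> rfl

variable {r t : ℕ}

/-- For t = 2 the modulus is 2(r + 1), so the removed matching pairs antipodal indices and is
invariant under rotation. -/
theorem sideAdj_shift (c i j : Fin (2 * r + t)) :
    SideAdj r t (shift c i) (shift c j) ↔ SideAdj r t i j := by
  have hi := i.2
  have hj := j.2
  have hc := c.2
  rw [sideAdj_iff, sideAdj_iff, shift_val, shift_val]
  split_ifs <;> omega

theorem crossAdj_shift (hr : 1 ≤ r) (c i j : Fin (2 * r + t)) :
    CrossAdj r t (shift c i) (shift c j) ↔ CrossAdj r t i j := by
  have hi := i.2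
  have hj := j.2
  have hc := c.2
  rw [crossAdj_iff hr, crossAdj_iff hr, shift_val, shift_val]
  split_ifs <;> omega

/-- The rotation `u_i ↦ u_{i+c}`, `v_i ↦ v_{i+c}`. -/
def rotation (hr : 1 ≤ r) (c : Fin (2 * r + t)) :
    poleGraph r t ≃g poleGraph r t where
  toFun
    | .x => .x
    | .y => .y
    | .u i => .u (shift c i)
    | .v i => .v (shift c i)
  invFun
    | .x => .x
    | .y => .y
    | .u i => .u ((shift c).symm i)
    | .v i => .v ((shift c).symm i)
  left_inv z := by cases z <;> simp
  right_inv z := by cases z <;> simp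
  map_rel_iff' {a b} := by
    cases a <;> cases b <;> simp [sideAdj_shift, crossAdj_shift hr]

/-- The reflection exchanging the two poles. -/
def reflection (hr : 1 ≤ r) : poleGraph r t ≃g poleGraph r t where
  toFun
    | .x => .y
    | .y => .x
    | .u i => .v i.rev
    | .v i => .u i.rev
  invFun
    | .x => .y
    | .y => .x
    | .u i => .v i.rev
    | .v i => .u i.rev
  left_inv z := by cases z <;> simp
  right_inv z := by cases z <;> simp
  map_rel_iff' {a b} := by
    -- Swapping u with v reverses the sign of an offset and reversing indices restores it, so cross
    -- edges survive.
    cases a <;> cases b <;> simp [sideAdj_iff, crossAdj_iff hr, Fin.val_rev] <;> omega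

end Automorphisms

/-! ### Distances, connectedness and diameter -/

section Metric

variable {r t : ℕ}

/-- The level of a vertex: its distance from `x`. -/
def level {n : ℕ} : PoleVertex n → ℝ
  | .x => 0
  | .u _ => 1
  | .v _ => 2
  | .y => 3

/-- Used twice: it forces the poles to be at distance at least 3, and it is the optimal potential
for the edge x u_0. -/
theorem level_sub_level_le (a b) (h : (poleGraph r t).Adj a b) : level b - level a ≤ 1 := by
  cases a <;> cases b <;> simp [level] at h ⊢ <;> norm_num

theorem crossAdj_self (i : Fin (2 * r + t)) : CrossAdj r t i i :=
  ⟨0, by omega, Nat.ModEq.refl _⟩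

/-- The edges u_i v_i give paths x, u_i, v_i, y, and u_i reaches v_j through x and u_j. Extended
distances are used so that connectedness can be deduced from the finite diameter. -/
theorem edist_le_three (hr : 1 ≤ r) (a b) : (poleGraph r t).edist a b ≤ 3 := by
  have wu : ∀ i, (poleGraph r t).edist .x (.u i) ≤ 1 := fun i =>
    (SimpleGraph.edist_eq_one_iff_adj.2 (adj_x_u i)).le
  have wv : ∀ i, (poleGraph r t).edist .y (.v i) ≤ 1 := fun i =>
    (SimpleGraph.edist_eq_one_iff_adj.2 (adj_y_v i)).le
  have wuv : ∀ i, (poleGraph r t).edist (.u i) (.v i) ≤ 1 := fun i =>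
    (SimpleGraph.edist_eq_one_iff_adj.2 (adj_u_v i i |>.2 (crossAdj_self i))).le
  have wvu : ∀ i, (poleGraph r t).edist (.v i) (.u i) ≤ 1 := fun i =>
    SimpleGraph.edist_comm.trans_le (wuv i)
  have wv' : ∀ i, (poleGraph r t).edist (.v i) .y ≤ 1 := fun i =>
    SimpleGraph.edist_comm.trans_le (wv i)
  have wuu : ∀ i j, (poleGraph r t).edist (.u i) (.u j) ≤ 2 := fun i j => by
    refine (SimpleGraph.edist_triangle (v := .x)).trans ?_
    rw [SimpleGraph.edist_comm]
    exact (add_le_add (wu i) (wu j)).trans (by norm_num)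
  have wvv : ∀ i j, (poleGraph r t).edist (.v i) (.v j) ≤ 2 := fun i j => by
    refine (SimpleGraph.edist_triangle (v := .y)).trans ?_
    rw [SimpleGraph.edist_comm]
    exact (add_le_add (wv i) (wv j)).trans (by norm_num)
  have wxv : ∀ i, (poleGraph r t).edist .x (.v i) ≤ 2 := fun i =>
    (SimpleGraph.edist_triangle (v := .u i)).trans
      ((add_le_add (wu i) (wuv i)).trans (by norm_num))
  have wyu : ∀ i, (poleGraph r t).edist .y (.u i) ≤ 2 := fun i => by
    refine (SimpleGraph.edist_triangle (v := .v i)).trans ?_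
    exact (add_le_add (wv i) (wvu i)).trans (by norm_num)
  have wuv' : ∀ i j, (poleGraph r t).edist (.u i) (.v j) ≤ 3 := fun i j =>
    (SimpleGraph.edist_triangle (v := .u j)).trans
      ((add_le_add (wuu i j) (wuv j)).trans (by norm_num))
  have wxy : (poleGraph r t).edist .x .y ≤ 3 := by
    refine (SimpleGraph.edist_triangle (v := .v ⟨0, by omega⟩)).trans ?_
    exact (add_le_add (wxv _) (wv' _)).trans (by norm_num)
  have h13 : (1 : ℕ∞) ≤ 3 := by norm_num
  have h23 : (2 : ℕ∞) ≤ 3 := by norm_num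
  rcases a with _ | _ | i | i <;> rcases b with _ | _ | j | j
  · simp
  · exact wxy
  · exact (wu j).trans h13
  · exact (wxv j).trans h23
  · exact SimpleGraph.edist_comm.trans_le wxy
  · simp
  · exact (wyu j).trans h23
  · exact (wv j).trans h13
  · exact SimpleGraph.edist_comm.trans_le ((wu i).trans h13)
  · exact SimpleGraph.edist_comm.trans_le ((wyu i).trans h23)
  · exact (wuu i j).trans h23
  · exact wuv' i j
  · exact SimpleGraph.edist_comm.trans_le ((wxv i).trans h23)
  · exact SimpleGraph.edist_comm.trans_le ((wv i).trans h13)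
  · exact SimpleGraph.edist_comm.trans_le (wuv' j i)
  · exact (wvv i j).trans h23

instance {n : ℕ} : Nonempty (PoleVertex n) := ⟨.x⟩

theorem connected_poleGraph (hr : 1 ≤ r) : (poleGraph r t).Connected :=
  SimpleGraph.connected_of_ediam_ne_top (ne_top_of_le_ne_top (by decide : (3 : ℕ∞) ≠ ⊤)
    (SimpleGraph.ediam_le_of_edist_le (edist_le_three hr)))

theorem dist_le_three (hr : 1 ≤ r) (a b) : (poleGraph r t).dist a b ≤ 3 := by
  have := edist_le_three (t := t) hr a b
  rw [← ((connected_poleGraph hr).preconnected a b).coe_dist_eq_edist] at this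
  exact_mod_cast this

theorem dist_x_y (hr : 1 ≤ r) : (poleGraph r t).dist .x .y = 3 := by
  refine le_antisymm (dist_le_three hr _ _) ?_
  have := sub_le_dist (connected_poleGraph (t := t) hr) level_sub_level_le .x .y
  simp only [level, sub_zero] at this
  exact_mod_cast this

theorem ediam_poleGraph (hr : 1 ≤ r) : (poleGraph r t).ediam = 3 := by
  refine le_antisymm (SimpleGraph.ediam_le_of_edist_le (edist_le_three hr)) ?_
  have := SimpleGraph.edist_le_ediam (G := poleGraph r t) (u := .x) (v := .y)
  rwa [← ((connected_poleGraph hr).preconnected _ _).coe_dist_eq_edist, dist_x_y hr] at this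

end Metric

/-! ### Index blocks and vertex sets given by type -/

section Segments

/-- The increasing enumeration of `c, …, c + m - 1`. -/
def seg {n : ℕ} (c m : ℕ) (h : c + m ≤ n) (i : Fin m) : Fin n := ⟨c + i, by omega⟩

theorem seg_injective {n : ℕ} {c m : ℕ} (h : c + m ≤ n) : Function.Injective (seg c m h) := by
  intro i j e
  simpa [seg, Fin.ext_iff] using e

theorem exists_seg_eq {n : ℕ} {c m : ℕ} (h : c + m ≤ n) (j : Fin n) :
    (∃ i, seg c m h i = j) ↔ c ≤ j ∧ (j : ℕ) < c + m := by
  constructor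
  · rintro ⟨i, rfl⟩
    simp [seg]
  · rintro ⟨h₁, h₂⟩
    exact ⟨⟨j - c, by omega⟩, Fin.ext (by simp [seg]; omega)⟩

open Classical in
/-- The set of vertices given by its intersections with `{x}`, `{y}`, the `u_i` and the `v_i`. -/
noncomputable def poleSet {n : ℕ} (p q : Prop) (P Q : Fin n → Prop) : Finset (PoleVertex n) :=
  Finset.univ.filter fun
    | .x => p
    | .y => q
    | .u i => P i
    | .v i => Q i

variable {n : ℕ} {p q : Prop} {P Q : Fin n → Prop}

@[simp] theorem x_mem_poleSet : .x ∈ poleSet p q P Q ↔ p := by simp [poleSet]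
@[simp] theorem y_mem_poleSet : .y ∈ poleSet p q P Q ↔ q := by simp [poleSet]
@[simp] theorem u_mem_poleSet (i) : .u i ∈ poleSet p q P Q ↔ P i := by simp [poleSet]
@[simp] theorem v_mem_poleSet (i) : .v i ∈ poleSet p q P Q ↔ Q i := by simp [poleSet]

end Segments

/-! ### Degrees and irregularity -/

section Degrees

variable {r t : ℕ}

theorem card_filter_lt {n m : ℕ} (h : m ≤ n) :
    (Finset.univ.filter fun j : Fin n => (j : ℕ) < m).card = m := by
  rw [Fin.card_filter_val_lt]
  omega

theorem crossAdj_zero_iff (hr : 1 ≤ r) (h : 0 < 2 * r + t) (j : Fin (2 * r + t)) :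
    CrossAdj r t ⟨0, h⟩ j ↔ (j : ℕ) < r + 2 := by
  rw [crossAdj_iff hr]
  dsimp only
  omega

theorem sideAdj_zero_iff (h : 0 < 2 * r + t) (j : Fin (2 * r + t)) :
    SideAdj r t ⟨0, h⟩ j ↔ (j : ℕ) ≠ 0 ∧ (t = 2 → (j : ℕ) ≠ r + 1) := by
  rw [sideAdj_iff]
  dsimp only
  omega

open Classical in
theorem sum_crossAdj_zero (hr : 1 ≤ r) (ht : t = 1 ∨ t = 2) (h : 0 < 2 * r + t) :
    ∑ j, (if CrossAdj r t ⟨0, h⟩ j then (1 : ℝ) else 0) = r + 2 := by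
  simp_rw [crossAdj_zero_iff hr]
  rw [Finset.sum_boole, card_filter_lt (by omega)]
  push_cast
  rfl

open Classical in
-- Both cases give 2r: for t = 1 only u_0 itself is lost from 2r + 1 indices, for t = 2 also its
-- antipode from 2r + 2.
theorem sum_sideAdj_zero (ht : t = 1 ∨ t = 2) (h : 0 < 2 * r + t) :
    ∑ j, (if SideAdj r t ⟨0, h⟩ j then (1 : ℝ) else 0) = 2 * r := by
  simp_rw [sideAdj_zero_iff]
  rcases ht with rfl | rfl
  · calc _ = ∑ j : Fin (2 * r + 1), ((1 : ℝ) - if j = ⟨0, h⟩ then 1 else 0) := by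
          refine Finset.sum_congr rfl fun j _ => ?_
          by_cases hj : (j : ℕ) = 0 <;> simp [Fin.ext_iff, hj]
      _ = _ := by
          rw [Finset.sum_sub_distrib, Finset.sum_ite_eq', if_pos (Finset.mem_univ _)]
          simp
  · calc _ = ∑ j : Fin (2 * r + 2), ((1 : ℝ) - (if j = ⟨0, h⟩ then 1 else 0) -
            if j = ⟨r + 1, by omega⟩ then 1 else 0) := by
          refine Finset.sum_congr rfl fun j _ => ?_
          by_cases hj : (j : ℕ) = 0 <;> by_cases hj' : (j : ℕ) = r + 1
          · omega
          all_goals simp [Fin.ext_iff, hj, hj']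
      _ = _ := by
          rw [Finset.sum_sub_distrib, Finset.sum_sub_distrib, Finset.sum_ite_eq',
            Finset.sum_ite_eq', if_pos (Finset.mem_univ _), if_pos (Finset.mem_univ _)]
          simp
          ring

open Classical in
theorem degree_u (hr : 1 ≤ r) (ht : t = 1 ∨ t = 2) (i : Fin (2 * r + t)) :
    (poleGraph r t).degree (.u i) = 3 * r + 3 := by
  have h0 : 0 < 2 * r + t := by omega
  have hi : PoleVertex.u i = rotation hr i (.u ⟨0, h0⟩) := by
    change PoleVertex.u i = PoleVertex.u (shift i ⟨0, h0⟩)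
    congr 1
    ext
    simp [shift_val]
  rw [hi, degree_iso]
  have : ((poleGraph r t).degree (.u ⟨0, h0⟩) : ℝ) = 3 * r + 3 := by
    rw [← sum_adj_eq_degree, PoleVertex.sum_eq]
    simp only [adj_u_x, not_adj_u_y, adj_u_u, adj_u_v, if_true, if_false,
      sum_sideAdj_zero ht, sum_crossAdj_zero hr ht]
    ring
  exact_mod_cast this

open Classical in
theorem degree_v (hr : 1 ≤ r) (ht : t = 1 ∨ t = 2) (i : Fin (2 * r + t)) :
    (poleGraph r t).degree (.v i) = 3 * r + 3 := by
  rw [← degree_u hr ht i.rev, ← degree_iso (reflection hr) (.u i.rev)]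
  change _ = (poleGraph r t).degree (.v i.rev.rev)
  rw [Fin.rev_rev]

open Classical in
theorem degree_x : (poleGraph r t).degree .x = 2 * r + t := by
  have : ((poleGraph r t).degree .x : ℝ) = 2 * r + t := by
    rw [← sum_adj_eq_degree, PoleVertex.sum_eq]
    simp
  exact_mod_cast this

theorem isIrregular_poleGraph (hr : 1 ≤ r) (ht : t = 1 ∨ t = 2) : IsIrregular (poleGraph r t) := by
  rintro ⟨d, hd⟩
  have h₁ := hd .x
  have h₂ := hd (.u ⟨0, by omega⟩)
  rw [degree_x] at h₁
  rw [degree_u hr ht] at h₂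
  omega

end Degrees

/-! ### Ball matchings for edges missing the poles -/

section Moves

variable {r t : ℕ}

theorem dist_le_one {V : Type*} {G : SimpleGraph V} {a b : V} (h : G.Adj a b) : G.dist a b ≤ 1 :=
  (SimpleGraph.dist_eq_one_iff_adj.2 h).le

/-- With D = 3r + 3 and cost r + 2, the bound (D + 1 - (r + 2))/D is exactly 2/3. -/
theorem curvatureBound_of_movesTo {a b : PoleVertex (2 * r + t)} (hab : (poleGraph r t).Adj a b)
    {S T : Finset _} (hS : ∀ z, z ∈ S ↔ z = a ∨ (poleGraph r t).Adj a z)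
    (hT : ∀ z, z ∈ T ↔ z = b ∨ (poleGraph r t).Adj b z) (h : MovesTo (poleGraph r t) S T (r + 2))
    (ha : ∃ i, a = .u i ∨ a = .v i) (hb : ∃ i, b = .u i ∨ b = .v i)
    (hr : 1 ≤ r) (ht : t = 1 ∨ t = 2) :
    CurvatureBound (poleGraph r t) (2 / 3) a b := by
  have hd : ∀ c : PoleVertex (2 * r + t), (∃ i, c = .u i ∨ c = .v i) →
      open Classical in (poleGraph r t).degree c = 3 * r + 3 := by
    rintro c ⟨i, rfl | rfl⟩
    exacts [degree_u hr ht i, degree_v hr ht i]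
  convert MovesTo.curvatureBound hab (by omega) (hd a ha) (hd b hb) hS hT h using 1
  push_cast
  field_simp
  ring

/-- Moving a block of consecutive `v`s. -/
theorem movesTo_v {S T : Finset (PoleVertex (2 * r + t))} {c d m k : ℕ} (hc : c + m ≤ 2 * r + t)
    (hd : d + m ≤ 2 * r + t) (hx : .x ∈ S ↔ .x ∈ T) (hy : .y ∈ S ↔ .y ∈ T)
    (hu : ∀ i : Fin (2 * r + t), .u i ∈ S ↔ .u i ∈ T)
    (hv : ∀ i : Fin (2 * r + t), .v i ∈ S ∧ .v i ∉ T ↔ c ≤ i ∧ (i : ℕ) < c + m)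
    (hv' : ∀ i : Fin (2 * r + t), .v i ∈ T ∧ .v i ∉ S ↔ d ≤ i ∧ (i : ℕ) < d + m)
    (hcd : ∀ i, SideAdj r t (seg c m hc i) (seg d m hd i)) (hk : m ≤ k) :
    MovesTo (poleGraph r t) S T k := by
  refine movesTo_of_range (c := 1) (fun i => .v (seg c m hc i)) (fun i => .v (seg d m hd i))
    (fun i j e => seg_injective hc (PoleVertex.v.inj e))
    (fun i j e => seg_injective hd (PoleVertex.v.inj e)) ?_ ?_
    (fun i => dist_le_one (hcd i)) (by omega)
  · rintro (_ | _ | i | i)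
    · simp [hx]
    · simp [hy]
    · simp [hu]
    · simp [hv, exists_seg_eq]
  · rintro (_ | _ | i | i)
    · simp [hx]
    · simp [hy]
    · simp [hu]
    · simp [hv', exists_seg_eq]

/-- Moving a block of consecutive `u`s to a block of consecutive `v`s. -/
theorem movesTo_u_v {S T : Finset (PoleVertex (2 * r + t))} {c d m k : ℕ}
    (hc : c + m ≤ 2 * r + t)
    (hd : d + m ≤ 2 * r + t) (hx : .x ∈ S ↔ .x ∈ T) (hy : .y ∈ S ↔ .y ∈ T)
    (hu : ∀ i : Fin (2 * r + t), .u i ∈ S ∧ .u i ∉ T ↔ c ≤ i ∧ (i : ℕ) < c + m) (hu' : ∀ i, .u i ∈ T → .u i ∈ S)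
    (hv : ∀ i : Fin (2 * r + t), .v i ∈ S → .v i ∈ T)
    (hv' : ∀ i : Fin (2 * r + t), .v i ∈ T ∧ .v i ∉ S ↔ d ≤ i ∧ (i : ℕ) < d + m)
    (hcd : ∀ i, CrossAdj r t (seg c m hc i) (seg d m hd i)) (hk : m ≤ k) :
    MovesTo (poleGraph r t) S T k := by
  refine movesTo_of_range (c := 1) (fun i => .u (seg c m hc i)) (fun i => .v (seg d m hd i))
    (fun i j e => seg_injective hc (PoleVertex.u.inj e))
    (fun i j e => seg_injective hd (PoleVertex.v.inj e)) ?_ ?_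
    (fun i => dist_le_one (hcd i)) (by omega)
  · rintro (_ | _ | i | i)
    · simp [hx]
    · simp [hy]
    · simp [hu, exists_seg_eq]
    · simpa using hv i
  · rintro (_ | _ | i | i)
    · simp [hx]
    · simp [hy]
    · simpa using hu' i
    · simp [hv', exists_seg_eq]

theorem curvatureBound_u_zero_u (hr : 1 ≤ r) (ht : t = 1 ∨ t = 2) {s : ℕ} (hs₀ : 1 ≤ s)
    (hs : s ≤ r) :
    CurvatureBound (poleGraph r t) (2 / 3) (.u ⟨0, by omega⟩) (.u ⟨s, by omega⟩) := by
  refine curvatureBound_of_movesTo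
    (S := poleSet True False (fun i : Fin (2 * r + t) => t = 2 → (i : ℕ) ≠ r + 1) (fun i => (i : ℕ) < r + 2))
    (T := poleSet True False (fun i : Fin (2 * r + t) => t = 2 → (i : ℕ) ≠ s + (r + 1))
      (fun i => (s ≤ i ∧ (i : ℕ) ≤ s + r + 1) ∨ (i : ℕ) + (2 * r + t) ≤ s + r + 1))
    ?_ ?_ ?_ ?_ ⟨_, .inl rfl⟩ ⟨_, .inl rfl⟩ hr ht
  · rw [adj_u_u, sideAdj_zero_iff]
    dsimp only
    omega
  · rintro (_ | _ | i | i)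
    · simp
    · simp
    · simp [sideAdj_zero_iff, Fin.ext_iff]
      omega
    · simp [crossAdj_zero_iff hr]
  · rintro (_ | _ | i | i)
    · simp
    · simp
    · simp [sideAdj_iff, Fin.ext_iff]
      omega
    · simp [crossAdj_iff hr]
  rcases ht with rfl | rfl
  -- For t = 1 the u-parts agree and all v's are mutually adjacent. When s = r the ball of u_s wraps
  -- round to v_0, which is then common to both balls, so the moved block loses one element.
  · rcases hs.lt_or_eq with hs | rfl
    · refine movesTo_v (c := 0) (d := r + 2) (m := s) (by omega) (by omega) (by simp) (by simp)
        (by simp) ?_ ?_ ?_ (by omega)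
      · intro i
        have hi := i.2
        rw [v_mem_poleSet, v_mem_poleSet]
        omega
      · intro i
        have hi := i.2
        rw [v_mem_poleSet, v_mem_poleSet]
        omega
      · intro i
        simp [sideAdj_iff, seg]
    · refine movesTo_v (c := 1) (d := s + 2) (m := s - 1) (by omega) (by omega) (by simp) (by simp)
        (by simp) ?_ ?_ ?_ (by omega)
      · intro i
        have hi := i.2
        rw [v_mem_poleSet, v_mem_poleSet]
        omega
      · intro i
        have hi := i.2
        rw [v_mem_poleSet, v_mem_poleSet]
        omega
      · intro i
        simp [sideAdj_iff, seg]
  -- For t = 2 the missing antipodes are exchanged first, at cost 1. The v-block then jumps by r +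
  -- 2, which avoids the nonadjacent difference r + 1.
  · have h₁ : MovesTo (poleGraph r 2)
        (poleSet True False (fun i => 2 = 2 → (i : ℕ) ≠ r + 1) (fun i => (i : ℕ) < r + 2))
        (poleSet True False (fun i => 2 = 2 → (i : ℕ) ≠ s + (r + 1)) (fun i => (i : ℕ) < r + 2))
        1 := by
      refine movesTo_single (.u ⟨s + (r + 1), by omega⟩) (.u ⟨r + 1, by omega⟩) ?_ ?_
        (dist_le_one ?_)
      · rintro (_ | _ | i | i) <;> simp [Fin.ext_iff]
        omega
      · rintro (_ | _ | i | i) <;> simp [Fin.ext_iff]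
        omega
      · simp [sideAdj_iff]
        omega
    have h₂ : MovesTo (poleGraph r 2)
        (poleSet True False (fun i => 2 = 2 → (i : ℕ) ≠ s + (r + 1)) (fun i => (i : ℕ) < r + 2))
        (poleSet True False (fun i => 2 = 2 → (i : ℕ) ≠ s + (r + 1))
          (fun i => (s ≤ i ∧ (i : ℕ) ≤ s + r + 1) ∨ (i : ℕ) + (2 * r + 2) ≤ s + r + 1))
        (r + 1) := by
      refine movesTo_v (c := 0) (d := r + 2) (m := s) (by omega) (by omega) (by simp) (by simp)
        (by simp) ?_ ?_ ?_ (by omega)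
      · intro i
        have hi := i.2
        rw [v_mem_poleSet, v_mem_poleSet]
        omega
      · intro i
        have hi := i.2
        rw [v_mem_poleSet, v_mem_poleSet]
        omega
      · intro i
        simp [sideAdj_iff, seg]
        omega
    exact (add_comm 1 (r + 1)) ▸ h₁.trans (connected_poleGraph hr) h₂

theorem curvatureBound_u_zero_v (hr : 1 ≤ r) (ht : t = 1 ∨ t = 2) {s : ℕ} (hs : s ≤ r + 1) :
    CurvatureBound (poleGraph r t) (2 / 3) (.u ⟨0, by omega⟩) (.v ⟨s, by omega⟩) := by
  have hn : 0 < 2 * r + t := by omega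
  have hG := connected_poleGraph (t := t) hr
  refine curvatureBound_of_movesTo
    (S := poleSet True False (fun i : Fin (2 * r + t) => t = 2 → (i : ℕ) ≠ r + 1) (fun i => (i : ℕ) < r + 2))
    (T := poleSet False True
      (fun i => ¬ (s + 1 ≤ i ∧ (i : ℕ) < s + 1 + (r + t - 2)))
      (fun i : Fin (2 * r + t) => t = 2 → (i : ℕ) ≠ s + (r + 1) ∧ s ≠ (i : ℕ) + (r + 1)))
    ?_ ?_ ?_ ?_ ⟨_, .inl rfl⟩ ⟨_, .inr rfl⟩ hr ht
  · rw [adj_u_v, crossAdj_zero_iff hr]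
    dsimp only
    omega
  · rintro (_ | _ | i | i)
    · simp
    · simp
    · simp [sideAdj_zero_iff, Fin.ext_iff]
      omega
    · simp [crossAdj_zero_iff hr]
  · rintro (_ | _ | i | i)
    · simp
    · simp
    · have hi := i.2
      simp [crossAdj_iff hr]
      omega
    · simp [sideAdj_iff, Fin.ext_iff]
      omega
  -- The r + t - 2 u's not adjacent to v_s go to the r + t - 2 v's not adjacent to u_0, with
  -- constant offset r + 1 - s. The parameter `q` records whether y is already occupied.
  have hτ : ∀ q : Prop, MovesTo (poleGraph r t)
      (poleSet False q (fun _ => True) (fun i => (i : ℕ) < r + 2))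
      (poleSet False q (fun i => ¬ (s + 1 ≤ i ∧ (i : ℕ) < s + 1 + (r + t - 2)))
        (fun _ => True)) (r + t - 2) := by
    intro q
    refine movesTo_u_v (c := s + 1) (d := r + 2) (m := r + t - 2) (by omega) (by omega) (by simp)
      (by simp) ?_ ?_ ?_ ?_ ?_ (by omega)
    · intro i
      simp
    · simp
    · simp
    · intro i
      have hi := i.2
      simp
      omega
    · intro i
      rw [crossAdj_iff hr]
      dsimp only [seg]
      omega
  rcases ht with rfl | rfl
  -- For t = 1, x goes straight to y at cost 3, and 3 + (r - 1) = r + 2.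
  · have h₁ : MovesTo (poleGraph r 1)
        (poleSet True False (fun i => 1 = 2 → (i : ℕ) ≠ r + 1) (fun i => (i : ℕ) < r + 2))
        (poleSet False True (fun _ => True) (fun i => (i : ℕ) < r + 2)) 3 := by
      refine movesTo_single .x .y ?_ ?_ (dist_le_three hr _ _)
      · rintro (_ | _ | i | i) <;> simp
      · rintro (_ | _ | i | i) <;> simp
    have h₂ := h₁.trans hG (hτ True)
    rw [show 3 + (r + 1 - 2) = r + 2 by omega] at h₂
    convert h₂ using 2
    simp
  -- For t = 2, x fills the missing antipode of u_0 and the antipode of v_s moves to y: 1 + r + 1 =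
  -- r + 2.
  · have h₁ : MovesTo (poleGraph r 2)
        (poleSet True False (fun i => 2 = 2 → (i : ℕ) ≠ r + 1) (fun i => (i : ℕ) < r + 2))
        (poleSet False False (fun _ => True) (fun i => (i : ℕ) < r + 2)) 1 := by
      refine movesTo_single .x (.u ⟨r + 1, by omega⟩) ?_ ?_ (dist_le_one (adj_x_u _))
      · rintro (_ | _ | i | i) <;> simp
      · rintro (_ | _ | i | i) <;> simp [Fin.ext_iff]
    have h₃ : MovesTo (poleGraph r 2)
        (poleSet False False (fun i => ¬ (s + 1 ≤ i ∧ (i : ℕ) < s + 1 + (r + 2 - 2)))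
          (fun _ => True))
        (poleSet False True (fun i => ¬ (s + 1 ≤ i ∧ (i : ℕ) < s + 1 + (r + 2 - 2)))
          (fun i => 2 = 2 → (i : ℕ) ≠ s + (r + 1) ∧ s ≠ (i : ℕ) + (r + 1))) 1 := by
      refine movesTo_single (.v ⟨if s = r + 1 then 0 else s + (r + 1), by split_ifs <;> omega⟩) .y
        ?_ ?_ (dist_le_one (adj_v_y _))
      · rintro (_ | _ | i | i) <;> simp [Fin.ext_iff]
        split_ifs <;> omega
      · rintro (_ | _ | i | i) <;> simp
    have h₂ := (h₁.trans hG (hτ False)).trans hG h₃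
    rwa [show 1 + (r + 2 - 2) + 1 = r + 2 by omega] at h₂

end Moves

/-! ### The edge x u_0: optimal transport by a fractional flow -/

section Flow

variable {r t : ℕ}

/-- The part of the flow from the `u_k` to the `v_j` with `1 ≤ j ≤ r`. -/
noncomputable def innerFlow (r t : ℕ) (k j : Fin (2 * r + t)) : ℝ :=
  if (1 ≤ (j : ℕ) ∧ (j : ℕ) ≤ r) ∧ (k : ℕ) = j then 1 / 2
  else if (1 ≤ (j : ℕ) ∧ (j : ℕ) ≤ r) ∧ (k : ℕ) + 1 = r + t + j then 1 / 2 else 0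

theorem innerFlow_nonneg (k j : Fin (2 * r + t)) : 0 ≤ innerFlow r t k j := by
  unfold innerFlow
  split_ifs <;> norm_num

/-- Each inner v_j is fed by the two extreme offsets, 0 from u_j and r + 1 from u_{j+r+t-1}. As j
runs over 1, …, r these sources are distinct and fill the two stated ranges. -/
theorem sum_innerFlow_row (ht : t = 1 ∨ t = 2) (k : Fin (2 * r + t)) :
    ∑ j, innerFlow r t k j =
      if (1 ≤ (k : ℕ) ∧ (k : ℕ) ≤ r) ∨ r + t ≤ (k : ℕ) then 1 / 2 else 0 := by
  have hk := k.2
  split_ifs with h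
  · have key : ∃ j : Fin (2 * r + t), ∀ i, innerFlow r t k i = if i = j then 1 / 2 else 0 := by
      rcases h with h | h
      · refine ⟨k, fun i => ?_⟩
        unfold innerFlow
        simp only [Fin.ext_iff]
        split_ifs <;> first | rfl | omega
      · refine ⟨⟨k + 1 - (r + t), by omega⟩, fun i => ?_⟩
        unfold innerFlow
        simp only [Fin.ext_iff]
        split_ifs <;> first | rfl | omega
    obtain ⟨j, hj⟩ := key
    simp [hj]
  · refine Finset.sum_eq_zero fun j _ => ?_
    unfold innerFlow
    split_ifs <;> first | rfl | omega

theorem sum_innerFlow_col (ht : t = 1 ∨ t = 2) (j : Fin (2 * r + t)) :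
    ∑ k, innerFlow r t k j = if 1 ≤ (j : ℕ) ∧ (j : ℕ) ≤ r then 1 else 0 := by
  split_ifs with h
  · have key : ∀ k, innerFlow r t k j = (if k = j then 1 / 2 else 0) +
        if k = ⟨j + (r + t) - 1, by omega⟩ then 1 / 2 else 0 := by
      intro k
      unfold innerFlow
      simp only [Fin.ext_iff]
      split_ifs <;> first | omega | norm_num
    simp only [key, Finset.sum_add_distrib, Finset.sum_ite_eq', Finset.mem_univ, if_true]
    norm_num
  · refine Finset.sum_eq_zero fun k _ => ?_
    unfold innerFlow
    split_ifs <;> first | rfl | omega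

open Classical in
-- The inner flow serves v_1, …, v_r, so only the end vertices remain: `w` is what enters v_0 and
-- `w'` what enters v_{r+1}. The support conditions keep both on cross edges.
theorem exists_flow_of_weights (hr : 1 ≤ r) (ht : t = 1 ∨ t = 2) (h0 : 0 < 2 * r + t)
    (R : Fin (2 * r + t) → ℝ)
    (w w' : Fin (2 * r + t) → ℝ) (hw : ∀ k, 0 ≤ w k) (hw' : ∀ k, 0 ≤ w' k)
    (hs : ∑ k, w k = 1) (hs' : ∑ k, w' k = 1)
    (hadj : ∀ k, w k ≠ 0 → (k : ℕ) = 0 ∨ r + 1 ≤ (k : ℕ))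
    (hadj' : ∀ k, w' k ≠ 0 → (k : ℕ) ≤ r + 1)
    (hR : ∀ k : Fin (2 * r + t),
      (if (1 ≤ (k : ℕ) ∧ (k : ℕ) ≤ r) ∨ r + t ≤ (k : ℕ) then 1 / 2 else 0) + w k + w' k = R k) :
    ∃ f : Fin (2 * r + t) → Fin (2 * r + t) → ℝ, (∀ k j, 0 ≤ f k j) ∧
      (∀ k j, f k j ≠ 0 → CrossAdj r t k j) ∧ (∀ k, ∑ j, f k j = R k) ∧
      ∀ j, ∑ k, f k j = if CrossAdj r t ⟨0, h0⟩ j then 1 else 0 := by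
  refine ⟨fun k j => innerFlow r t k j + (if j = ⟨0, h0⟩ then w k else 0) +
    if j = ⟨r + 1, by omega⟩ then w' k else 0, ?_, ?_, ?_, ?_⟩
  · intro k j
    have := innerFlow_nonneg k j
    have := hw k
    have := hw' k
    dsimp only
    split_ifs <;> linarith
  · intro k j
    have hk := k.2
    contrapose!
    rw [crossAdj_iff hr]
    intro h
    have h₁ : innerFlow r t k j = 0 := by
      unfold innerFlow
      split_ifs <;> first | rfl | omega
    have h₂ : j = ⟨0, h0⟩ → w k = 0 := by
      rintro rfl
      by_contra hne
      have := hadj k hne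
      dsimp only at h
      omega
    have h₃ : j = ⟨r + 1, by omega⟩ → w' k = 0 := by
      intro hj
      by_contra hne
      have := hadj' k hne
      rw [Fin.ext_iff] at hj
      dsimp only at hj
      omega
    rw [h₁, ite_eq_right_iff.2 h₂, ite_eq_right_iff.2 h₃, add_zero, add_zero]
  · intro k
    rw [← hR k, ← sum_innerFlow_row ht]
    simp only [Finset.sum_add_distrib, Finset.sum_ite_eq', Finset.mem_univ, if_true]
  · intro j
    rw [Finset.sum_add_distrib, Finset.sum_add_distrib, sum_innerFlow_col ht]
    simp only [crossAdj_zero_iff hr, Finset.sum_ite_irrel, hs, hs', Finset.sum_const_zero,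
      Fin.ext_iff]
    split_ifs <;> first | omega | norm_num

open Classical in
-- In units of (1 - α)/(3r + 3), the row sums are the excess of the walk at x on each u_k over the
-- mass kept there, and the column sums are the demand of the walk at u_0 on the v's.
theorem exists_flow (hr : 1 ≤ r) (ht : t = 1 ∨ t = 2) (h0 : 0 < 2 * r + t) :
    ∃ f : Fin (2 * r + t) → Fin (2 * r + t) → ℝ, (∀ k j, 0 ≤ f k j) ∧
      (∀ k j, f k j ≠ 0 → CrossAdj r t k j) ∧
      (∀ k, ∑ j, f k j = (3 * r + 3) / (2 * r + t) -
        if k = ⟨0, h0⟩ ∨ SideAdj r t ⟨0, h0⟩ k then 1 else 0) ∧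
      ∀ j, ∑ k, f k j = if CrossAdj r t ⟨0, h0⟩ j then 1 else 0 := by
  rcases ht with rfl | rfl
  · have hr' : (0 : ℝ) < 2 * r + 1 := by positivity
    set b : ℝ := 3 / (2 * (2 * r + 1)) with hb
    have hb₀ : 0 ≤ b := by positivity
    have hb₁ : r * b ≤ 1 := by
      rw [hb, mul_div_assoc', div_le_one (by positivity)]
      linarith
    have hb₂ : b * (2 * r + 1) = 3 / 2 := by rw [hb]; field_simp
    have hq : ((3 : ℝ) * r + 3) / (2 * r + (1 : ℕ)) = 3 / 2 + b := by
      rw [div_eq_iff (by push_cast; positivity)]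
      push_cast
      linarith
    refine exists_flow_of_weights hr (.inl rfl) h0 _
      -- After the inner flow every u_k with k ≠ 0 has b left and u_0 has 1/2 + b. Each end vertex
      -- takes b from r of the former and tops up to 1 from u_0; the balance 2(1 - rb) = 1/2 + b is
      -- `hb₂`.
      (fun k => (if k = ⟨0, h0⟩ then 1 - r * b else 0) + if r + 1 ≤ (k : ℕ) then b else 0)
      (fun k => (if k = ⟨0, h0⟩ then 1 - r * b else 0) +
        if 1 ≤ (k : ℕ) ∧ (k : ℕ) ≤ r then b else 0) ?_ ?_ ?_ ?_ ?_ ?_ ?_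
    · intro k
      split_ifs <;> linarith
    · intro k
      split_ifs <;> linarith
    · have : ∀ k : Fin (2 * r + 1), (if r + 1 ≤ (k : ℕ) then b else 0) =
          b - if (k : ℕ) < r + 1 then b else 0 := by
        intro k
        split_ifs <;> first | omega | simp
      simp only [Finset.sum_add_distrib, Finset.sum_ite_eq', Finset.mem_univ, if_true, this,
        Finset.sum_sub_distrib, ← Finset.sum_filter, Finset.sum_const,
        card_filter_lt (show r + 1 ≤ 2 * r + 1 by omega), Finset.card_univ, Fintype.card_fin,
        nsmul_eq_mul]
      push_cast
      ring
    · have : ∀ k : Fin (2 * r + 1), (if 1 ≤ (k : ℕ) ∧ (k : ℕ) ≤ r then b else 0) =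
          (if (k : ℕ) < r + 1 then b else 0) - if k = ⟨0, h0⟩ then b else 0 := by
        intro k
        simp only [Fin.ext_iff]
        split_ifs <;> first | omega | simp
      simp only [Finset.sum_add_distrib, Finset.sum_ite_eq', Finset.mem_univ, if_true, this,
        Finset.sum_sub_distrib]
      rw [← Finset.sum_filter, Finset.sum_const,
        card_filter_lt (show r + 1 ≤ 2 * r + 1 by omega), nsmul_eq_mul]
      push_cast
      ring
    · intro k
      contrapose!
      intro h
      simp only [Fin.ext_iff]
      split_ifs <;> first | omega | simp
    · intro k
      contrapose!
      intro h
      simp only [Fin.ext_iff]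
      split_ifs <;> first | omega | simp
    · intro k
      rw [hq]
      simp only [sideAdj_zero_iff, Fin.ext_iff]
      split_ifs <;> first | omega | linarith
  · have hq : ((3 : ℝ) * r + 3) / (2 * r + (2 : ℕ)) = 3 / 2 := by
      rw [div_eq_iff (by push_cast; positivity)]
      push_cast
      ring
    refine exists_flow_of_weights hr (.inr rfl) h0 _
      -- Only u_0, with 1/2, and its antipode, with 3/2, have mass left; both are adjacent to both
      -- end vertices, so each splits evenly.
      (fun k => (if k = ⟨0, h0⟩ then 1 / 4 else 0) + if k = ⟨r + 1, by omega⟩ then 3 / 4 else 0)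
      (fun k => (if k = ⟨0, h0⟩ then 1 / 4 else 0) + if k = ⟨r + 1, by omega⟩ then 3 / 4 else 0)
      ?_ ?_ ?_ ?_ ?_ ?_ ?_
    · intro k
      split_ifs <;> norm_num
    · intro k
      split_ifs <;> norm_num
    · simp only [Finset.sum_add_distrib, Finset.sum_ite_eq', Finset.mem_univ, if_true]
      norm_num
    · simp only [Finset.sum_add_distrib, Finset.sum_ite_eq', Finset.mem_univ, if_true]
      norm_num
    · intro k
      contrapose!
      intro h
      simp only [Fin.ext_iff]
      split_ifs <;> first | omega | simp
    · intro k
      contrapose!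
      intro h
      simp only [Fin.ext_iff]
      split_ifs <;> first | omega | simp
    · intro k
      have hk := k.2
      rw [hq]
      simp only [sideAdj_zero_iff, Fin.ext_iff, true_implies]
      split_ifs <;> first | omega | norm_num

/-- The coupling moving mass from `x` to `u_0` and along the edges `u_k v_j`. -/
noncomputable def poleCoupling {n : ℕ} (i : Fin n) (e p : ℝ) (g : Fin n → ℝ)
    (f : Fin n → Fin n → ℝ) : PoleVertex n → PoleVertex n → ℝ
  | .x, .x => p
  | .x, .u j => if j = i then e else 0
  | .u k, .u j => if j = k then g k else 0
  | .u k, .v j => p * f k j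
  | _, _ => 0

open Classical in
-- Mass p stays at x, α - p crosses to u_0, and total mass p(r + 2) flows along cross edges. The
-- cost is α + p(r + 1) = α + (1 - α)/3.
theorem transportDist_x_u_le (hr : 1 ≤ r) (ht : t = 1 ∨ t = 2) (h0 : 0 < 2 * r + t) {α : ℝ}
    (hα : 1 / 2 ≤ α) (hα₁ : α ≤ 1) :
    transportDist (poleGraph r t) (lazyWalk (poleGraph r t) α .x)
      (lazyWalk (poleGraph r t) α (.u ⟨0, h0⟩)) ≤ 1 - 2 / 3 * (1 - α) := by
  obtain ⟨f, hf, hfs, hrow, hcol⟩ := exists_flow hr ht h0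
  have hD : (0 : ℝ) < 3 * r + 3 := by positivity
  have hn : (0 : ℝ) < 2 * r + t := by exact_mod_cast h0
  set p : ℝ := (1 - α) / (3 * r + 3) with hp
  have hpD : p * (3 * r + 3) = 1 - α := div_mul_cancel₀ _ hD.ne'
  have hp₀ : 0 ≤ p := div_nonneg (by linarith) hD.le
  have hpα : p ≤ α := by
    rw [hp, div_le_iff₀ hD]
    nlinarith [(Nat.cast_nonneg r : (0 : ℝ) ≤ r)]
  have hq : (1 - α) / (2 * r + t) = p * ((3 * r + 3) / (2 * r + t)) := by
    rw [← hpD]; ring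
  set g : Fin (2 * r + t) → ℝ := fun k =>
    if k = ⟨0, h0⟩ ∨ SideAdj r t ⟨0, h0⟩ k then p else 0 with hg
  have hg₀ : ∀ k, 0 ≤ g k := fun k => by rw [hg]; dsimp only; split_ifs <;> linarith
  have hrow' : ∀ k, g k + ∑ j, p * f k j = (1 - α) / (2 * r + t) := by
    intro k
    rw [← Finset.mul_sum, hrow, hq, hg]
    dsimp only
    split_ifs <;> ring
  have hcol' : ∀ j, ∑ k, p * f k j = if CrossAdj r t ⟨0, h0⟩ j then p else 0 := by
    intro j
    rw [← Finset.mul_sum, hcol]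
    split_ifs <;> ring
  have hA : IsCoupling (lazyWalk (poleGraph r t) α .x)
      (lazyWalk (poleGraph r t) α (.u ⟨0, h0⟩)) (poleCoupling ⟨0, h0⟩ (α - p) p g f) := by
    refine isCoupling_of_nonneg ?_ ?_ ?_
      (isDistribution_lazyWalk (by linarith) hα₁ (adj_x_u ⟨0, h0⟩)).le_one
    · have : 0 ≤ α - p := by linarith
      rintro (_ | _ | k | k) (_ | _ | j | j) <;> simp only [poleCoupling, le_refl]
      · exact hp₀
      · split_ifs
        exacts [this, le_rfl]
      · split_ifs
        exacts [hg₀ k, le_rfl]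
      · exact mul_nonneg hp₀ (hf k j)
    · rintro (_ | _ | k | k) <;>
        simp [PoleVertex.sum_eq, poleCoupling, lazyWalk, degree_x]
      exact hrow' k
    · rintro (_ | _ | j | j) <;>
        simp only [PoleVertex.sum_eq, poleCoupling, lazyWalk, degree_u hr ht,
          Finset.sum_const_zero, add_zero, zero_add, adj_u_x, adj_u_u, adj_u_v, not_adj_u_y,
          if_true, if_false, reduceCtorEq, Finset.sum_ite_eq, Finset.mem_univ,
          PoleVertex.u.injEq, hcol']
      · push_cast
        rfl
      · rw [hg]
        push_cast
        by_cases h₁ : j = ⟨0, h0⟩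
        · simp [h₁]
        · simp [h₁, hp]
      · push_cast
        rfl
  refine (transportDist_le hA).trans ?_
  have hd : ∀ k j, p * f k j * ((poleGraph r t).dist (.u k) (.v j) : ℝ) = p * f k j := by
    intro k j
    by_cases h : f k j = 0
    · simp [h]
    · rw [SimpleGraph.dist_eq_one_iff_adj.2 ((adj_u_v k j).2 (hfs k j h))]
      simp
  have hd' : (poleGraph r t).dist .x (.u ⟨0, h0⟩) = 1 :=
    SimpleGraph.dist_eq_one_iff_adj.2 (adj_x_u _)
  have e : ∑ a, ∑ b, poleCoupling ⟨0, h0⟩ (α - p) p g f a b *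
      ((poleGraph r t).dist a b : ℝ) = α - p + p * (r + 2) := by
    have hs : ∑ k, ∑ j, p * f k j = p * (r + 2) := by
      rw [Finset.sum_comm]
      simp_rw [← Finset.mul_sum, hcol]
      rw [sum_crossAdj_zero hr ht]
    simp [PoleVertex.sum_eq, poleCoupling, hd, hd', hs]
  rw [e]
  linarith

open Classical in
-- Against `level`, the walk at x has mean 1 - α and the walk at u_0 has mean α + 4(1 - α)/3; the
-- difference equals the cost of the flow.
theorem le_transportDist_x_u (hr : 1 ≤ r) (ht : t = 1 ∨ t = 2) (h0 : 0 < 2 * r + t) {α : ℝ}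
    (hα : 0 ≤ α) (hα₁ : α ≤ 1) :
    1 - 2 / 3 * (1 - α) ≤ transportDist (poleGraph r t) (lazyWalk (poleGraph r t) α .x)
      (lazyWalk (poleGraph r t) α (.u ⟨0, h0⟩)) := by
  have hD : (0 : ℝ) < 3 * r + 3 := by positivity
  have hn : (0 : ℝ) < 2 * r + t := by exact_mod_cast h0
  have key := sum_sub_sum_le_transportDist (connected_poleGraph hr) level_sub_level_le
    (isDistribution_lazyWalk hα hα₁ (adj_x_u ⟨0, h0⟩))
    (isDistribution_lazyWalk hα hα₁ (adj_u_x ⟨0, h0⟩))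
  rw [sum_lazyWalk_mul, sum_lazyWalk_mul, degree_x, degree_u hr ht, PoleVertex.sum_eq,
    PoleVertex.sum_eq] at key
  have h2 : ∀ j, (if CrossAdj r t ⟨0, h0⟩ j then (2 : ℝ) else 0) =
      2 * if CrossAdj r t ⟨0, h0⟩ j then 1 else 0 := fun j => by split_ifs <;> ring
  simp only [level, adj_u_x, adj_u_u, adj_u_v, not_adj_u_y, adj_x_u, not_adj_x_x, not_adj_x_y,
    not_adj_x_v, if_true, if_false, h2, ← Finset.mul_sum, sum_crossAdj_zero hr ht,
    sum_sideAdj_zero ht, Finset.sum_const, Finset.card_univ, Fintype.card_fin, nsmul_eq_mul] at key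
  push_cast at key
  refine le_trans (le_of_eq ?_) key
  field_simp
  ring

end Flow

/-! ### All edges by symmetry, and sharpness -/

section Main

variable {r t : ℕ}

theorem rotation_u (hr : 1 ≤ r) (c i : Fin (2 * r + t)) :
    rotation hr c (.u i) = .u (shift c i) := rfl

theorem rotation_v (hr : 1 ≤ r) (c i : Fin (2 * r + t)) :
    rotation hr c (.v i) = .v (shift c i) := rfl

theorem curvatureBound_x_u (hr : 1 ≤ r) (ht : t = 1 ∨ t = 2) (i : Fin (2 * r + t)) :
    CurvatureBound (poleGraph r t) (2 / 3) .x (.u i) := by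
  have h0 : 0 < 2 * r + t := by omega
  have h : CurvatureBound (poleGraph r t) (2 / 3) .x (.u ⟨0, h0⟩) := by
    filter_upwards [eventually_mem_Ico (c := 1 / 2) (by norm_num)] with α hα
    exact transportDist_x_u_le hr ht h0 hα.1 hα.2.le
  have := h.iso (rotation hr i) (adj_x_u _)
  have hi : shift i ⟨0, h0⟩ = i := by
    ext
    simp [shift_val]
  rwa [rotation_u, hi] at this

theorem curvatureBound_u_u (hr : 1 ≤ r) (ht : t = 1 ∨ t = 2) {i j : Fin (2 * r + t)}
    (h : SideAdj r t i j) : CurvatureBound (poleGraph r t) (2 / 3) (.u i) (.u j) := by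
  wlog hij : (i : ℕ) < j generalizing i j
  · have h' : (poleGraph r t).Adj (.u j) (.u i) := ((adj_u_u i j).2 h).symm
    exact (this h' (by have := (sideAdj_iff i j).1 h; omega)).symm
  have hj := j.2
  rw [sideAdj_iff] at h
  by_cases hs : (j : ℕ) - i ≤ r
  · have hb := curvatureBound_u_zero_u hr ht (s := j - i) (by omega) hs
    have := hb.iso (rotation hr i) ((adj_u_u _ _).2 ((sideAdj_zero_iff _ _).2
      ⟨by dsimp only; omega, by dsimp only; omega⟩))
    rw [rotation_u, rotation_u] at this
    convert this using 2
    · ext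
      simp [shift_val]
    · ext
      rw [shift_val]
      dsimp only
      split_ifs <;> omega
  -- For a large gap, go round the cycle from u_j to u_i. The gap is at least r + 1 for t = 1, and
  -- at least r + 2 for t = 2 since antipodes are nonadjacent, so the complementary gap is at most
  -- r.
  · have hb := curvatureBound_u_zero_u hr ht (s := 2 * r + t - (j - i)) (by omega) (by omega)
    have := (hb.iso (rotation hr j) ((adj_u_u _ _).2 ((sideAdj_zero_iff _ _).2
      ⟨by dsimp only; omega, by dsimp only; omega⟩))).symm
    rw [rotation_u, rotation_u] at this
    convert this using 2
    · ext
      rw [shift_val]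
      dsimp only
      split_ifs <;> omega
    · ext
      simp [shift_val]

theorem curvatureBound_u_v (hr : 1 ≤ r) (ht : t = 1 ∨ t = 2) {i j : Fin (2 * r + t)}
    (h : CrossAdj r t i j) : CurvatureBound (poleGraph r t) (2 / 3) (.u i) (.v j) := by
  have hi := i.2
  have hj := j.2
  rw [crossAdj_iff hr] at h
  have hs : ∃ s, s ≤ r + 1 ∧ ((j : ℕ) = i + s ∨ (j : ℕ) + (2 * r + t) = i + s) := by
    rcases h with h | h
    · exact ⟨j - i, by omega, by omega⟩
    · exact ⟨j + (2 * r + t) - i, by omega, by omega⟩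
  obtain ⟨s, hs, hsj⟩ := hs
  have hb := curvatureBound_u_zero_v hr ht hs
  have := hb.iso (rotation hr i) ((adj_u_v _ _).2 ((crossAdj_zero_iff hr _ _).2
    (by dsimp only; omega)))
  rw [rotation_u, rotation_v] at this
  convert this using 2
  · ext
    simp [shift_val]
  · ext
    rw [shift_val]
    dsimp only
    split_ifs <;> omega

theorem reflection_v (hr : 1 ≤ r) (i : Fin (2 * r + t)) :
    reflection hr (.u i.rev) = .v i :=
  congrArg PoleVertex.v (Fin.rev_rev i)

theorem curvatureBound_of_adj (hr : 1 ≤ r) (ht : t = 1 ∨ t = 2) {a b : PoleVertex (2 * r + t)}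
    (h : (poleGraph r t).Adj a b) : CurvatureBound (poleGraph r t) (2 / 3) a b := by
  have hy : ∀ i, CurvatureBound (poleGraph r t) (2 / 3) .y (.v i) := by
    intro i
    rw [← reflection_v hr]
    exact (curvatureBound_x_u hr ht i.rev).iso (reflection hr) (adj_x_u _)
  rcases a with _ | _ | i | i <;> rcases b with _ | _ | j | j
  · exact h.elim
  · exact h.elim
  · exact curvatureBound_x_u hr ht j
  · exact h.elim
  · exact h.elim
  · exact h.elim
  · exact h.elim
  · exact hy j
  · exact (curvatureBound_x_u hr ht i).symm
  · exact h.elim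
  · exact curvatureBound_u_u hr ht h
  · exact curvatureBound_u_v hr ht h
  · exact h.elim
  · exact (hy i).symm
  · exact (curvatureBound_u_v hr ht h).symm
  · rw [← reflection_v hr, ← reflection_v hr] at h ⊢
    have h' := (reflection hr).map_adj_iff.1 h
    exact (curvatureBound_u_u hr ht h').iso (reflection hr) h'

theorem hasCurvature_x_u (hr : 1 ≤ r) (ht : t = 1 ∨ t = 2) (h0 : 0 < 2 * r + t) :
    HasCurvature (poleGraph r t) .x (.u ⟨0, h0⟩) (2 / 3) := by
  refine tendsto_const_nhds.congr' ?_
  filter_upwards [eventually_mem_Ico (c := 1 / 2) (by norm_num)] with α hα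
  have h₁ : 1 - α ≠ 0 := by linarith [hα.2]
  rw [alphaCurvature_of_adj (adj_x_u _), le_antisymm (transportDist_x_u_le hr ht h0 hα.1 hα.2.le)
    (le_transportDist_x_u hr ht h0 (by linarith [hα.1]) hα.2.le)]
  field_simp
  ring

theorem isMinCurvature_poleGraph (hr : 1 ≤ r) (ht : t = 1 ∨ t = 2) :
    IsMinCurvature (poleGraph r t) (2 / 3) := by
  refine ⟨fun a b hab => ?_, .x, .u ⟨0, by omega⟩, adj_x_u _, hasCurvature_x_u hr ht _⟩
  obtain ⟨k, hk⟩ := exists_hasCurvature (connected_poleGraph hr) hab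
  exact ⟨k, hk, (curvatureBound_of_adj hr ht hab).le_of_hasCurvature hab hk⟩

theorem isBonnetMyersSharp_poleGraph (hr : 1 ≤ r) (ht : t = 1 ∨ t = 2) :
    IsBonnetMyersSharp (poleGraph r t) := by
  have hd := ediam_poleGraph (t := t) hr
  refine ⟨connected_poleGraph hr, by rw [hd]; decide, 2 / 3, isMinCurvature_poleGraph hr ht,
    by norm_num, ?_⟩
  rw [SimpleGraph.diam, hd]
  norm_num

end Main

end LLY

theorem mainTheorem5 :
    (∀ r t : ℕ, 1 ≤ r → (t = 1 ∨ t = 2) →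
      (LLY.poleGraph r t).ediam = 3 ∧
      LLY.IsBonnetMyersSharp (LLY.poleGraph r t) ∧
      (LLY.poleGraph r t).dist LLY.PoleVertex.x LLY.PoleVertex.y = 3 ∧
      LLY.IsIrregular (LLY.poleGraph r t)) ∧
    (∀ r t r' t' : ℕ, 1 ≤ r → (t = 1 ∨ t = 2) → 1 ≤ r' → (t' = 1 ∨ t' = 2) →
      Nonempty (LLY.poleGraph r t ≃g LLY.poleGraph r' t') → r = r' ∧ t = t') := by
  refine ⟨fun r t hr ht => ⟨LLY.ediam_poleGraph hr, LLY.isBonnetMyersSharp_poleGraph hr ht,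
    LLY.dist_x_y hr, LLY.isIrregular_poleGraph hr ht⟩, ?_⟩
  rintro r t r' t' - ht - ht' ⟨φ⟩
  -- The order 4r + 2t + 2 determines 2r + t, whose parity determines t ∈ {1, 2} and then r.
  have := Fintype.card_congr φ.toEquiv
  rw [LLY.PoleVertex.card, LLY.PoleVertex.card] at this
  omega
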